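/- Let $R$ be a commutative noetherian ring, $\operatorname{mod} R$ the category of finitely generated $R$-modules, and $\operatorname{D_{sg}}(R)=\operatorname{D^b}(\operatorname{mod} R)/\operatorname{thick}(R)$ its singularity category. All subcategories are full and closed under isomorphisms. A subcategory $\mathcal X$ of $\operatorname{mod} R$ is resolving if it contains $R$ and is closed under direct summands, extensions and kernels of epimorphisms. For such $\mathcal X$, let $\operatorname{SW}(\mathcal X)$ denote its Spanier--Whitehead category, identified with the subcategory of $\operatorname{D_{sg}}(R)$ of all objects isomorphic to $M[m]$ with $M\in\mathcal X$ and $m\in\mathbb Z$. Let $\operatorname{IPD}(\mathcal X)$ be the set of primes $\mathfrak p$ of $R$ such that $\operatorname{pd}_{R_{\mathfrak p}}M_{\mathfrak p}=\infty$ for some $M\in\mathcal X$. For a subcategory $\mathcal C$ of a triangulated category $\mathcal T$, let $\langle\mathcal C\rangle$ be the subcategory of direct summands of finite (possibly empty) direct sums of shifts of objects of $\mathcal C$. Let $\mathcal C\ast\mathcal D$ be the subcategory of objects $Z$ in exact triangles $C\to Z\to D\to C[1]$ with $C\in\mathcal C$, $D\in\mathcal D$. Put $\mathcal C\diamond\mathcal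 D=\langle\langle\mathcal C\rangle\ast\langle\mathcal D\rangle\rangle$, $\langle\mathcal C\rangle_0=0$, $\langle\mathcal C\rangle_1=\langle\mathcal C\rangle$ and $\langle\mathcal C\rangle_r=\langle\mathcal C\rangle_{r-1}\diamond\langle\mathcal C\rangle$ for $r>1$; we write $\langle\mathcal C\rangle_r^{\mathcal T}$ to indicate $\mathcal T$. Let $\operatorname{filt}\mathcal C$ be the smallest extension-closed subcategory of $\operatorname{mod} R$ containing $\mathcal C$. For an ideal $I$, let $\mathrm V(I)$ be the set of primes containing $I$, let $\mu(I)$ be the minimal number of generators of $I$, and let $\operatorname{grade} I$ be the supremum of the lengths of $R$-regular sequences in $I$, with $\operatorname{grade} R=\infty$. Set $r(I)=\mu(I)-\operatorname{grade} I+1$ if $I\neq R$, and $r(R)=1$. Let $\mathcal X$ be a resolving subcategory of $\operatorname{mod} R$ and let $I$ be an ideal of $R$ such that $\operatorname{IPD}(\mathcal X)\subseteq \mathrm V(I)$ and $R/\mathfrak p\in\operatorname{SW}(\mathcal X)$ for every $\mathfrak p\in\mathrm V(I)$. Then $\operatorname{SW}(\mathcal X)$ is a triangulated subcategory of $\operatorname{D_{sg}}(R)$,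 it contains $\operatorname{filt}\{R/\mathfrak p\mid\mathfrak p\in\mathrm V(I)\}$, and $$\operatorname{SW}(\mathcal X)=\big\langle \operatorname{filt}\{R/\mathfrak p\mid \mathfrak p\in \mathrm V(I)\}\big\rangle^{\operatorname{SW}(\mathcal X)}_{r(I)}.$$ If, moreover, $I$ annihilates $\operatorname{End}_{\operatorname{SW}(\mathcal X)}(Z)$ for every $Z\in\operatorname{SW}(\mathcal X)$, then $\operatorname{SW}(\mathcal X)$ contains $\operatorname{mod} R/I$ (the finitely generated $R$-modules annihilated by $I$) and $$\operatorname{SW}(\mathcal X)=\langle \operatorname{mod} R/I\rangle^{\operatorname{SW}(\mathcal X)}_{r(I)}.$$ -/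

import Mathlib

open CategoryTheory CategoryTheory.Limits CategoryTheory.Pretriangulated

universe v u

namespace SpanierWhitehead

/-! ### Balls in a triangulated category -/

section Balls

variable {C : Type u} [Category.{v} C] [HasZeroObject C] [HasShift C ℤ] [Preadditive C]
  [∀ n : ℤ, (shiftFunctor C n).Additive] [Pretriangulated C]

/-- The additive closure of `P`: direct summands of finite (possibly empty) direct sums of
objects in `P`. -/
def addClosure (P : ObjectProperty C) : ObjectProperty C := fun Z =>
  ∃ (n : ℕ) (F : Fin n → C), (∀ i, P (F i)) ∧ Nonempty (Retract Z (⨁ F))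

/-- `⟨P⟩`: the additive closure of the shifts of objects in `P`. -/
def angle (P : ObjectProperty C) : ObjectProperty C :=
  addClosure (P.shiftClosure ℤ)

/-- `P ⋄ Q = ⟨⟨P⟩ ∗ ⟨Q⟩⟩`, where `A ∗ B` consists of the `Z` in an exact triangle
`A ⟶ Z ⟶ B ⟶ A⟦1⟧`. -/
def diamond (P Q : ObjectProperty C) : ObjectProperty C :=
  angle (ObjectProperty.extensionProduct (angle P) (angle Q))

/-- The ball `⟨P⟩_r` of radius `r` centered at `P`. -/
def ball (P : ObjectProperty C) : ℕ → ObjectProperty C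
  | 0 => fun Z => IsZero Z
  | 1 => angle P
  | r + 2 => diamond (ball P (r + 1)) (angle P)

end Balls

/-! ### The singularity category -/

section Singularity

variable (R : Type u) [CommRing R] [IsNoetherianRing R]

noncomputable instance hasDerivedCategoryFG : HasDerivedCategory.{u + 1} (FGModuleCat.{u} R) :=
  HasDerivedCategory.standard _

/-- The bounded derived category of finitely generated `R`-modules. -/
abbrev Db : Type (u + 1) := DerivedCategory.Bounded (FGModuleCat.{u} R)

/-- A finitely generated module, as a complex concentrated in degree `0`. -/
noncomputable def toDb : FGModuleCat.{u} R ⥤ Db R :=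
  ObjectProperty.lift _ (DerivedCategory.singleFunctor (FGModuleCat.{u} R) 0)
    fun _ => ⟨⟨0, inferInstance⟩, ⟨0, inferInstance⟩⟩

/-- The thick closure of `R` in the bounded derived category. -/
noncomputable abbrev perfect : ObjectProperty (Db R) :=
  (ObjectProperty.singleton ((toDb R).obj (FGModuleCat.of R R))).triangEnvelope

/-- The singularity category of `R`: the Verdier quotient of the bounded derived category by the
thick closure of `R`. -/
abbrev Dsg : Type (u + 1) := (perfect R).trW.Localization

/-- The canonical functor from finitely generated modules to the singularity category. -/
noncomputable def toDsg : FGModuleCat.{u} R ⥤ Dsg R :=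
  toDb R ⋙ (perfect R).trW.Q

end Singularity

/-! ### Subcategories of finitely generated modules -/

section Modules

variable {R : Type u} [CommRing R] [IsNoetherianRing R]

/-- Resolving subcategories of `mod R`. -/
structure IsResolving (X : ObjectProperty (FGModuleCat.{u} R)) : Prop where
  self_mem : X (FGModuleCat.of R R)
  summand : ∀ {M N : FGModuleCat.{u} R}, Nonempty (Retract M N) → X N → X M
  extension : ∀ S : ShortComplex (FGModuleCat.{u} R), S.ShortExact → X S.X₁ → X S.X₃ → X S.X₂
  kernel : ∀ S : ShortComplex (FGModuleCat.{u} R), S.ShortExact → X S.X₂ → X S.X₃ → X S.X₁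

/-- `filt P`: the smallest (strict, full) extension-closed subcategory of `mod R`
containing `P`. -/
inductive Filt (P : ObjectProperty (FGModuleCat.{u} R)) : FGModuleCat.{u} R → Prop
  | of_mem {M} : P M → Filt P M
  | of_iso {M N} : (M ≅ N) → Filt P M → Filt P N
  | extension (S : ShortComplex (FGModuleCat.{u} R)) :
      S.ShortExact → Filt P S.X₁ → Filt P S.X₃ → Filt P S.X₂

/-- The modules `R/𝔭` with `𝔭` in `V(I)`. -/
def cyclicPrimes (I : Ideal R) : ObjectProperty (FGModuleCat.{u} R) := fun M =>
  ∃ p ∈ PrimeSpectrum.zeroLocus (I : Set R),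
    Nonempty (M ≅ FGModuleCat.of R (R ⧸ p.asIdeal))

/-- `mod R/I` as a subcategory of `mod R`: the finitely generated modules killed by `I`. -/
def modQuotient (I : Ideal R) : ObjectProperty (FGModuleCat.{u} R) := fun M =>
  I ≤ Module.annihilator R M

/-- The infinite projective dimension locus of a finitely generated module. -/
def ipd (M : FGModuleCat.{u} R) : Set (PrimeSpectrum R) :=
  {p | projectiveDimension (ModuleCat.of.{u} (Localization.AtPrime p.asIdeal)
    (LocalizedModule p.asIdeal.primeCompl M)) = ⊤}

/-- The infinite projective dimension locus of a subcategory of `mod R`. -/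
def ipdLocus (X : ObjectProperty (FGModuleCat.{u} R)) : Set (PrimeSpectrum R) :=
  {p | ∃ M, X M ∧ p ∈ ipd M}

/-- The grade of `I` on `R`: the supremum of the lengths of `R`-regular sequences in `I`.
For proper `I` a weakly regular sequence in `I` is regular; for `I = R` this gives the usual
convention `grade R = ∞`. -/
noncomputable def idealGrade (I : Ideal R) : ℕ∞ :=
  ⨆ (rs : List R) (_ : (∀ r ∈ rs, r ∈ I) ∧ RingTheory.Sequence.IsWeaklyRegular R rs),
    (rs.length : ℕ∞)

/-- The number `μ(I) - grade I + 1`. For proper `I` one has `grade I ≤ μ(I)`, so the subtraction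
is the honest one; for `I = R`, where `grade I = ∞`, the value is `1`. -/
noncomputable def radius (I : Ideal R) : ℕ :=
  ((I.spanFinrank : ℕ∞) - idealGrade I + 1).toNat

/-- The Spanier–Whitehead category of `X`, as a strict full subcategory of the singularity
category: its objects are those isomorphic to shifts of modules in `X`. -/
def SW (X : ObjectProperty (FGModuleCat.{u} R)) : ObjectProperty (Dsg R) := fun Z =>
  ∃ (M : FGModuleCat.{u} R) (m : ℤ), X M ∧ Nonempty (Z ≅ ((toDsg R).obj M)⟦m⟧)

/-- The annihilator of a subcategory of the singularity category: the intersection of the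
annihilators of the `R`-modules `End(Z)`. -/
noncomputable def ann (P : ObjectProperty (Dsg R)) : Ideal R :=
  ⨅ (Z : Dsg R) (_ : P Z), Module.annihilator R (Z ⟶ Z)

/-- The modules in `P`, regarded as objects of the singularity category. -/
noncomputable def inDsg (P : ObjectProperty (FGModuleCat.{u} R)) : ObjectProperty (Dsg R) :=
  P.map (toDsg R)

end Modules

end SpanierWhitehead

set_option linter.unusedSectionVars false

/-! Up to shift, every object of SW(X) is a module N in X, so it suffices to bound the radius of
such modules, after any convenient change of N within its class.

Choose μ(I) scalars that generate I up to radical and vanish on N in the singularity category. The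
cone of a zero endomorphism splits, so N is there a direct summand of its Koszul object on these
scalars (`nonempty_retract_koszulDsg`). In the derived category itself the scalars kill the Koszul
object, hence also its truncations. Its cohomology is therefore supported on V(I), and each
cohomological degree costs one step of radius (`ballIn_of_isGE_of_isLE`). A priori there are μ(I) +
1 degrees.

To save grade I of them, replace N by a syzygy. By Rees' theorem Ext into R from modules supported
on V(I) vanishes below the grade; dimension shifting transfers this to a high syzygy
(`IsResolving.exists_syzygy_homVanish`), and it forces the lowest cohomology of the Koszul object to
vanish (`koszul_isGE_of_homVanish`).

The scalars are powers of generators of I: wherever N has finite projective dimension, some scalar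
outside the prime kills it, so the locus hypothesis puts I in the radical of the annihilator of N
(`exists_pow_smul_eq_zero`). If I annihilates SW(X), the generators themselves serve, and the
cohomology lies in mod R/I.

SW(X) is triangulated because, modulo perfect complexes and shifts, every morphism in it comes from
a surjection between modules of X, whose kernel lies in X. -/

namespace SpanierWhitehead

/-! ### Koszul complexes as iterated cones of scalars -/

section Koszul
open CochainComplex CochainComplex.HomComplex
variable {R : Type*} [CommRing R] {A : Type*} [Category* A] [Abelian A] [Linear R A]

lemma ofHom_smul {K L : CochainComplex A ℤ} (x : R) (f : K ⟶ L) :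
    Cochain.ofHom (x • f) = x • Cochain.ofHom f := by ext; simp

/-- The homotopy carries the target copy of K identically onto the shifted source copy and is zero
on the latter; the differential of the cone turns it into multiplication by x. -/
lemma nullHomotopic_smul_mappingCone_self (x : R) (K : CochainComplex A ℤ) :
    Nonempty (Homotopy (x • 𝟙 (mappingCone (x • 𝟙 K))) 0) := by
  refine ⟨mappingCone.descHomotopy _ _ _ 0 (mappingCone.inl _) ?_ ?_⟩
  · simp [ofHom_smul]
  · simp

/-- A null-homotopy of y on K acts diagonally on the cone, with a sign on the shifted copy. The two
halves are compatible because the map being coned is a scalar. -/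
lemma nullHomotopic_smul_mappingCone (x y : R) (K : CochainComplex A ℤ)
    (h : Nonempty (Homotopy (y • 𝟙 K) 0)) :
    Nonempty (Homotopy (y • 𝟙 (mappingCone (x • 𝟙 K))) 0) := by
  obtain ⟨h⟩ := h
  obtain ⟨z, hz⟩ := Cochain.equivHomotopy _ _ h
  simp only [ofHom_smul, Cochain.ofHom_zero, add_zero] at hz
  refine ⟨mappingCone.descHomotopy _ _ _ (-(z.comp (mappingCone.inl _) (by lia)))
    (z.comp (Cochain.ofHom (mappingCone.inr _)) (add_zero _)) ?_ ?_⟩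
  · simp only [δ_neg, δ_comp z (mappingCone.inl (x • 𝟙 K)) 
        (show -1 + -1 = (-2 : ℤ) by lia) 0 0 (-1) (by lia) (by lia) (by lia),
      ← hz]
    simp [ofHom_smul]
  · simp [ofHom_smul, ← hz]

/-- The Koszul complex of a sequence of scalars on `K`, as an iterated mapping cone. -/
noncomputable def koszul (K : CochainComplex A ℤ) : List R → CochainComplex A ℤ
  | [] => K
  | x :: xs => mappingCone (x • 𝟙 (koszul K xs))

lemma nullHomotopic_smul_koszul (K : CochainComplex A ℤ) {xs : List R} {x : R} (hx : x ∈ xs) :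
    Nonempty (Homotopy (x • 𝟙 (koszul K xs)) 0) := by
  induction xs with
  | nil => simp at hx
  | cons y ys ih =>
    obtain rfl | hx := List.mem_cons.1 hx
    · exact nullHomotopic_smul_mappingCone_self _ _
    · exact nullHomotopic_smul_mappingCone _ _ _ (ih hx)

variable [HasDerivedCategory A]

lemma smul_id_Q_koszul_eq_zero (K : CochainComplex A ℤ) {xs : List R} {x : R} (hx : x ∈ xs) :
    x • 𝟙 (DerivedCategory.Q.obj (koszul K xs)) = 0 := by
  obtain ⟨h⟩ := nullHomotopic_smul_koszul K hx
  have := HomotopyCategory.eq_of_homotopy _ _ h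
  have := DerivedCategory.Qh.congr_map this
  have h2 : DerivedCategory.Q.map (x • 𝟙 (koszul K xs)) = DerivedCategory.Q.map 0 := this
  simpa using h2

end Koszul

/-! ### Vanishing ranges for Hom, and scalars on triangles -/

section HomVanish

variable {C : Type*} [Category* C] [HasZeroObject C] [HasShift C ℤ] [Preadditive C]
  [∀ n : ℤ, (shiftFunctor C n).Additive] [Pretriangulated C]

/-- All morphisms `X ⟶ Y⟦i⟧` with `i < c` vanish. -/
def HomVanish (X Y : C) (c : ℤ) : Prop := ∀ i < c, ∀ f : X ⟶ Y⟦i⟧, f = 0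

lemma HomVanish.mono {X Y : C} {c d : ℤ} (h : HomVanish X Y c) (hd : d ≤ c) : HomVanish X Y d :=
  fun i hi f => h i (by lia) f

lemma HomVanish.of_iso_left {X Y Z : C} {c : ℤ} (h : HomVanish X Y c) (e : X ≅ Z) :
    HomVanish Z Y c := fun i hi f => by
  have := h i hi (e.hom ≫ f)
  rwa [← cancel_epi e.hom, comp_zero]

lemma HomVanish.shift {X Y : C} {c : ℤ} (h : HomVanish X Y c) (n d : ℤ) (hd : d + n = c) :
    HomVanish X (Y⟦n⟧) d := fun i hi f => by
  have := h (n + i) (by lia) (f ≫ (shiftFunctorAdd C n i).inv.app Y)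
  rwa [← cancel_mono ((shiftFunctorAdd C n i).inv.app Y), zero_comp]

lemma HomVanish.shift_left {X Y : C} {c : ℤ} (h : HomVanish X Y c) (n d : ℤ) (hd : d = c + n) :
    HomVanish (X⟦n⟧) Y d := fun i hi f => by
  have h1 := h (i - n) (by lia)
    ((shiftShiftNeg X n).inv ≫ f⟦-n⟧' ≫ (shiftFunctorAdd' C i (-n) (i - n) (by lia)).inv.app Y)
  have h2 : f⟦-n⟧' = 0 := by
    rwa [← cancel_epi (shiftShiftNeg X n).inv,
      ← cancel_mono ((shiftFunctorAdd' C i (-n) (i - n) (by lia)).inv.app Y), Category.assoc,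
      comp_zero, zero_comp]
  exact (shiftFunctor C (-n)).map_injective (by simpa using h2)

lemma HomVanish.obj₂ {X : C} {c : ℤ} {T : Triangle C} (hT : T ∈ distTriang C)
    (h₁ : HomVanish X T.obj₁ c) (h₃ : HomVanish X T.obj₃ c) : HomVanish X T.obj₂ c :=
  fun i hi f => by
    obtain ⟨g, hg⟩ := Triangle.coyoneda_exact₂ _ (Triangle.shift_distinguished _ hT i) f
      (h₃ i hi _)
    exact hg.trans ((congrArg (· ≫ _) (h₁ i hi g)).trans zero_comp)

lemma HomVanish.obj₃ {X : C} {c : ℤ} {T : Triangle C} (hT : T ∈ distTriang C)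
    (h₁ : HomVanish X T.obj₁ (c + 1)) (h₂ : HomVanish X T.obj₂ c) : HomVanish X T.obj₃ c :=
  HomVanish.obj₂ (rot_of_distTriang _ hT) h₂ (h₁.shift 1 c rfl)

lemma HomVanish.obj₁ {X : C} {c : ℤ} {T : Triangle C} (hT : T ∈ distTriang C)
    (h₂ : HomVanish X T.obj₂ c) (h₃ : HomVanish X T.obj₃ (c - 1)) : HomVanish X T.obj₁ c :=
  HomVanish.obj₂ (inv_rot_of_distTriang _ hT) (h₃.shift (-1) c (by lia)) h₂

variable {R : Type*} [CommRing R] [Linear R C] [∀ n : ℤ, (shiftFunctor C n).Linear R]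

/-- If `y` acts nilpotently on `X`, then vanishing passes from the cone of `y` on `Y` to `Y`. -/
lemma HomVanish.of_cone_smul {X Y Z : C} {c : ℤ} {y : R} {g : Y ⟶ Z} {h : Z ⟶ Y⟦(1 : ℤ)⟧}
    (hT : Triangle.mk (y • 𝟙 Y) g h ∈ distTriang C) (hZ : HomVanish X Z (c - 1))
    {k : ℕ} (hy : y ^ k • 𝟙 X = 0) : HomVanish X Y c := fun i hi f => by
  -- The kernel of y on Hom(X, Y⟦i⟧) is the image of Hom(X, Z⟦i - 1⟧), which vanishes; so y is
  -- injective there, and also nilpotent.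
  have inj : ∀ f : X ⟶ Y⟦i⟧, y • f = 0 → f = 0 := fun f hf => by
    obtain ⟨g, hg⟩ := Triangle.coyoneda_exact₂ _
      (Triangle.shift_distinguished _ (inv_rot_of_distTriang _ hT) i) f (by
        change f ≫ (i.negOnePow • (y • 𝟙 Y)⟦i⟧') = 0
        simp [Functor.map_smul, Linear.comp_units_smul, hf])
    exact hg.trans ((congrArg (· ≫ _) ((hZ.shift (-1) c (by lia)) i hi g)).trans zero_comp)
  have : y ^ k • f = 0 := by
    rw [← Category.id_comp f, ← Linear.smul_comp, hy, zero_comp]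
  clear hy
  induction k with
  | zero => simpa using this
  | succ k ih => exact ih (inj _ (by rwa [smul_smul, ← pow_succ']))

/-- A scalar which vanishes on an object is zero on all of its retracts. -/
lemma smul_id_eq_zero_of_retract {X Y : C} (h : Retract X Y) {y : R} (hy : y • 𝟙 Y = 0) :
    y • 𝟙 X = 0 := by
  rw [← h.retract, ← Category.id_comp h.r, ← Linear.comp_smul, ← Linear.smul_comp, hy]; simp

lemma smul_id_eq_zero_of_iso {X Y : C} (e : X ≅ Y) {y : R} (hy : y • 𝟙 Y = 0) :
    y • 𝟙 X = 0 := smul_id_eq_zero_of_retract (Retract.ofIso e) hy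

lemma smul_id_shift_eq_zero {X : C} {y : R} (hy : y • 𝟙 X = 0) (n : ℤ) : y • 𝟙 (X⟦n⟧) = 0 := by
  rw [← CategoryTheory.Functor.map_id, ← Functor.map_smul, hy, Functor.map_zero]

lemma smul_id_shift_eq_zero_iff {X : C} {y : R} {n : ℤ} :
    y • 𝟙 (X⟦n⟧) = 0 ↔ y • 𝟙 X = 0 :=
  ⟨fun h => smul_id_eq_zero_of_iso (shiftShiftNeg X n).symm (smul_id_shift_eq_zero h (-n)),
    fun h => smul_id_shift_eq_zero h n⟩

/-- If `x` is zero on `X`, then `X` is a retract of the cone of `x`. -/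
lemma nonempty_retract_of_cone {X Z : C} {f : X ⟶ X} (hf : f = 0) {g : X ⟶ Z}
    {h : Z ⟶ X⟦(1 : ℤ)⟧} (hT : Triangle.mk f g h ∈ distTriang C) : Nonempty (Retract X Z) := by
  subst hf
  obtain ⟨r, hr⟩ := Triangle.yoneda_exact₂ _ hT (𝟙 X) zero_comp
  exact ⟨⟨g, r, hr.symm⟩⟩

/-- If a scalar `y` is zero on `X`, and `x` is zero on `X`, then `y` is zero on the cone of `x`. -/
lemma smul_id_cone_eq_zero {X Z : C} {f : X ⟶ X} (hf : f = 0) {g : X ⟶ Z}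
    {h : Z ⟶ X⟦(1 : ℤ)⟧} (hT : Triangle.mk f g h ∈ distTriang C) {y : R} (hy : y • 𝟙 X = 0) :
    y • 𝟙 Z = 0 := by
  subst hf
  obtain ⟨(s : X⟦(1 : ℤ)⟧ ⟶ Z), hs⟩ := Triangle.coyoneda_exact₁ _ hT (𝟙 (X⟦(1 : ℤ)⟧))
    ((Category.id_comp _).trans (Functor.map_zero _ _ _))
  replace hs : 𝟙 (X⟦(1 : ℤ)⟧) = s ≫ h := hs
  obtain ⟨(t : Z ⟶ X), ht⟩ := Triangle.coyoneda_exact₃ _ hT (𝟙 Z - h ≫ s)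
    (show (𝟙 Z - h ≫ s) ≫ h = 0 by simp [← hs])
  replace ht : 𝟙 Z - h ≫ s = t ≫ g := ht
  have hg : y • g = 0 := by rw [← Category.id_comp g, ← Linear.smul_comp, hy, zero_comp]
  have hh : y • h = 0 := by
    rw [← Category.comp_id h, ← Linear.comp_smul, smul_id_shift_eq_zero hy, comp_zero]
  rw [sub_eq_iff_eq_add.1 ht, smul_add, ← Linear.comp_smul, hg, ← Linear.smul_comp, hh]
  simp

end HomVanish

/-! ### Scalars and truncation -/

section Truncation

open DerivedCategory.TStructure Triangulated

variable {C : Type*} [Category* C] [HasZeroObject C] [HasShift C ℤ] [Preadditive C]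
  [∀ n : ℤ, (shiftFunctor C n).Additive] [Pretriangulated C] [IsTriangulated C]
  {R : Type*} [CommRing R] [Linear R C] [∀ n : ℤ, (shiftFunctor C n).Linear R]
  (t : TStructure C)

lemma smul_id_truncLE_eq_zero {K : C} {y : R} (hy : y • 𝟙 K = 0) (n : ℤ) :
    y • 𝟙 ((t.truncLE n).obj K) = 0 := by
  apply t.to_truncLE_obj_ext
  rw [Linear.smul_comp, Category.id_comp, zero_comp]
  have : (t.truncLEι n).app K = (t.truncLEι n).app K ≫ 𝟙 K := (Category.comp_id _).symm
  rw [this, ← Linear.comp_smul, hy, comp_zero]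

lemma smul_id_truncGT_eq_zero {K : C} {y : R} (hy : y • 𝟙 K = 0) (n : ℤ) :
    y • 𝟙 ((t.truncGT n).obj K) = 0 := by
  apply t.from_truncGE_obj_ext (n := n + 1)
  change (t.truncGTπ n).app K ≫ _ = (t.truncGTπ n).app K ≫ 0
  rw [Linear.comp_smul, Category.comp_id, comp_zero]
  have : (t.truncGTπ n).app K = 𝟙 K ≫ (t.truncGTπ n).app K := (Category.id_comp _).symm
  rw [this, ← Linear.smul_comp, hy, zero_comp]

/-- An object which receives no nonzero morphisms from the truncation `τ≤n` lies in degrees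
`> n`. -/
lemma isGE_of_truncLEι_eq_zero {K : C} {n : ℤ} (h : (t.truncLEι n).app K = 0) :
    t.IsGE K (n + 1) := by
  rw [t.isGE_iff_isZero_truncLE_obj n (n + 1) rfl, IsZero.iff_id_eq_zero]
  apply t.to_truncLE_obj_ext
  rw [h, comp_zero, comp_zero]

end Truncation

/-! ### Cohomological amplitude of Koszul objects -/

section KoszulTriangle

open DerivedCategory

variable {R : Type*} [CommRing R] {A : Type*} [Category* A] [Abelian A] [Linear R A]
  [HasDerivedCategory A] (K : CochainComplex A ℤ)

lemma exists_koszul_triangle (x : R) (xs : List R) :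
    ∃ (g : Q.obj (koszul K xs) ⟶ Q.obj (koszul K (x :: xs)))
      (h : Q.obj (koszul K (x :: xs)) ⟶ (Q.obj (koszul K xs))⟦(1 : ℤ)⟧),
      Triangle.mk (x • 𝟙 (Q.obj (koszul K xs))) g h ∈ distTriang (DerivedCategory A) := by
  let T := Q.mapTriangle.obj (CochainComplex.mappingCone.triangle (x • 𝟙 (koszul K xs)))
  refine ⟨T.mor₂, T.mor₃, ?_⟩
  have hT : T ∈ distTriang _ := mappingCone_triangle_distinguished (x • 𝟙 (koszul K xs))
  have h : T.mor₁ = x • 𝟙 (Q.obj (koszul K xs)) :=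
    (Functor.map_smul Q x (𝟙 (koszul K xs))).trans (by rw [Q.map_id])
  rw [← h]
  exact hT

/-- In the long exact sequence of Hom(X, -), each cone costs one degree. -/
lemma HomVanish.koszul {X : DerivedCategory A} {c : ℤ} (h : HomVanish X (Q.obj K) c)
    (xs : List R) : HomVanish X (Q.obj (koszul K xs)) (c - xs.length) := by
  induction xs with
  | nil => simpa [SpanierWhitehead.koszul] using h
  | cons x xs ih =>
    obtain ⟨g, h, hT⟩ := exists_koszul_triangle K x xs
    exact HomVanish.obj₃ hT (ih.mono (by simp)) (ih.mono (by simp; lia))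

lemma koszul_isLE (n : ℤ) [h : (Q.obj K).IsLE n] (xs : List R) :
    (Q.obj (koszul K xs)).IsLE n := by
  induction xs with
  | nil => exact h
  | cons x xs ih =>
    obtain ⟨g, h, hT⟩ := exists_koszul_triangle K x xs
    have := TStructure.t.isLE_shift (Q.obj (koszul K xs)) n 1 (n - 1)
    exact TStructure.t.isLE₂ _ (rot_of_distTriang _ hT) n ih
      (TStructure.t.isLE_of_le ((Q.obj (koszul K xs))⟦(1 : ℤ)⟧) (n - 1) n)

lemma koszul_isGE (n : ℤ) [h : (Q.obj K).IsGE n] (xs : List R) :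
    (Q.obj (koszul K xs)).IsGE (n - xs.length) := by
  induction xs with
  | nil => simpa [koszul] using h
  | cons x xs ih =>
    obtain ⟨g, h, hT⟩ := exists_koszul_triangle K x xs
    have := TStructure.t.isGE_shift (Q.obj (koszul K xs)) (n - xs.length) 1
      (n - (x :: xs).length) (by simp; lia)
    exact TStructure.t.isGE₂ _ (rot_of_distTriang _ hT) (n - (x :: xs).length)
      (TStructure.t.isGE_of_ge (Q.obj (koszul K xs)) _ (n - xs.length) (by simp; lia)) this

/-- If all shifted morphisms into `K` from objects killed by `xs` vanish below degree `c`,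
then so does the Koszul object of `K`, up to the length of `xs`. -/
lemma koszul_isGE_of_homVanish {n c : ℤ} [(Q.obj K).IsGE n] [(Q.obj K).IsLE 0] {xs : List R}
    (hK : ∀ T : A, (∀ x ∈ xs, x • 𝟙 T = 0) →
      HomVanish ((singleFunctor A 0).obj T) (Q.obj K) c) :
    (Q.obj (koszul K xs)).IsGE (c - xs.length) := by
  set Z := Q.obj (koszul K xs)
  have hn : Z.IsGE (n - xs.length) := koszul_isGE K n xs
  obtain h | h := le_or_gt c n
  · exact TStructure.t.isGE_of_ge Z _ (n - xs.length)
  -- The lower bound is raised one degree at a time, from the one that holds for every Koszul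
  -- object.
  suffices ∀ k : ℕ, ∀ m : ℤ, m ≤ c - xs.length → m = n - xs.length + k → Z.IsGE m from
    this (c - n).toNat _ le_rfl (by lia)
  intro k
  induction k with
  | zero => rintro m - rfl; simpa using hn
  | succ k ih =>
    rintro _ hm rfl
    obtain ⟨m, rfl⟩ : ∃ m, m = n - xs.length + k := ⟨_, rfl⟩
    have h1 := ih _ (by push_cast at hm; lia) rfl
    set m := n - xs.length + k
    have e : n - xs.length + ((k + 1 : ℕ) : ℤ) = m + 1 := by push_cast; lia
    rw [e] at hm ⊢
    apply isGE_of_truncLEι_eq_zero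
    -- Since Z lies in degrees ≥ m, its truncation τ≤m is a module T in degree m, killed by `xs`.
    -- The map from it to Z is then in the vanishing range, so T contributes nothing.
    obtain ⟨T, ⟨i⟩⟩ := exists_iso_singleFunctor_obj_of_isGE_of_isLE
      ((TStructure.t.truncLE m).obj Z) m
    let j : (singleFunctor A m).obj T ≅ ((singleFunctor A 0).obj T)⟦-m⟧ :=
      ((singleFunctors A).shiftIso (-m) m 0 (by lia)).symm.app T
    have hT : ∀ x ∈ xs, x • 𝟙 T = 0 := fun x hx => by
      apply (singleFunctor A 0).map_injective
      have := smul_id_truncLE_eq_zero TStructure.t (smul_id_Q_koszul_eq_zero K hx) m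
      have := smul_id_eq_zero_of_iso (i ≪≫ j).symm this
      rw [smul_id_shift_eq_zero_iff] at this
      simpa [Functor.map_smul] using this
    have h2 := ((((hK T hT).koszul K xs).shift_left (-m) _ rfl).of_iso_left (i ≪≫ j).symm)
      0 (by lia) ((TStructure.t.truncLEι m).app Z ≫ (shiftFunctorZero _ ℤ).inv.app Z)
    rwa [← cancel_mono ((shiftFunctorZero _ ℤ).inv.app Z), zero_comp]

end KoszulTriangle

/-! ### Finitely generated modules and prime filtrations -/

section FG
variable {R : Type u} [CommRing R] [IsNoetherianRing R]

section
variable {M N P : Type u} [AddCommGroup M] [AddCommGroup N] [AddCommGroup P] [Module R M]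
  [Module R N] [Module R P] [Module.Finite R M] [Module.Finite R N] [Module.Finite R P]

/-- The short complex of finitely generated modules attached to two composable linear maps. -/
abbrev fgShortComplex (f : M →ₗ[R] N) (g : N →ₗ[R] P) (h : Function.Exact f g) :
    ShortComplex (FGModuleCat.{u} R) :=
  ShortComplex.mk (X₁ := FGModuleCat.of R M) (X₂ := FGModuleCat.of R N) (X₃ := FGModuleCat.of R P)
    (FGModuleCat.ofHom f) (FGModuleCat.ofHom g)
    (by ext x; exact DFunLike.congr_fun h.linearMap_comp_eq_zero x)

lemma fgShortComplex_shortExact (f : M →ₗ[R] N) (g : N →ₗ[R] P) (h : Function.Exact f g)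
    (hf : Function.Injective f) (hg : Function.Surjective g) :
    (fgShortComplex f g h).ShortExact where
  exact := by
    rw [← ShortComplex.exact_map_iff_of_faithful _ (forget₂ (FGModuleCat.{u} R) (ModuleCat.{u} R)),
      ShortComplex.ShortExact.moduleCat_exact_iff_function_exact]
    exact h
  mono_f := (forget₂ (FGModuleCat.{u} R) (ModuleCat.{u} R)).mono_of_mono_map
    ((ModuleCat.mono_iff_injective _).2 hf)
  epi_g := (forget₂ (FGModuleCat.{u} R) (ModuleCat.{u} R)).epi_of_epi_map
    ((ModuleCat.epi_iff_surjective _).2 hg)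

end

lemma isZero_of_subsingleton (T : FGModuleCat.{u} R) (h : Subsingleton T) : IsZero T := by
  rw [IsZero.iff_id_eq_zero]
  ext x
  exact Subsingleton.elim (α := T) _ _

lemma fg_surjective_of_epi {M N : FGModuleCat.{u} R} (f : M ⟶ N) [Epi f] :
    Function.Surjective f.hom.hom :=
  (ModuleCat.epi_iff_surjective ((forget₂ (FGModuleCat.{u} R) (ModuleCat.{u} R)).map f)).1
    inferInstance

scoped instance fg_projective (P : Type u) [AddCommGroup P] [Module R P] [Module.Finite R P]
    [Module.Projective R P] : Projective (FGModuleCat.of R P) where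
  factors {E X} f e _ := by
    obtain ⟨h, hh⟩ := Module.projective_lifting_property e.hom.hom f.hom.hom
      (fg_surjective_of_epi e)
    exact ⟨FGModuleCat.ofHom h, by ext x; exact DFunLike.congr_fun hh x⟩

/-- Every finitely generated module is the cokernel of a submodule of a free module. -/
lemma exists_syzygy (M : FGModuleCat.{u} R) :
    ∃ (n : ℕ) (K : FGModuleCat.{u} R) (i : K ⟶ FGModuleCat.of R (Fin n → R))
      (p : FGModuleCat.of R (Fin n → R) ⟶ M) (w : i ≫ p = 0),
      (ShortComplex.mk i p w).ShortExact := by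
  obtain ⟨n, π, hπ⟩ := Module.Finite.exists_fin' R M
  exact ⟨n, FGModuleCat.of R (LinearMap.ker π), FGModuleCat.ofHom (LinearMap.ker π).subtype,
    FGModuleCat.ofHom π, _, fgShortComplex_shortExact _ π (LinearMap.exact_subtype_ker_map π)
      (Submodule.injective_subtype _) hπ⟩

/-- A property of finitely generated modules which holds for zero modules and for `R` and which
is closed under extensions holds for finitely generated free modules. -/
lemma prop_free {P : ObjectProperty (FGModuleCat.{u} R)}
    (h0 : ∀ M : FGModuleCat.{u} R, Subsingleton M → P M)
    (hR : P (FGModuleCat.of R R))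
    (hext : ∀ S : ShortComplex (FGModuleCat.{u} R), S.ShortExact → P S.X₁ → P S.X₃ → P S.X₂)
    (n : ℕ) : P (FGModuleCat.of R (Fin n → R)) := by
  induction n with
  | zero => exact h0 _ (inferInstanceAs (Subsingleton (Fin 0 → R)))
  | succ n ih =>
    let f : (Fin n → R) →ₗ[R] (Fin (n + 1) → R) :=
      { toFun := fun x => Fin.cons 0 x
        map_add' := fun x y => by ext i; cases i using Fin.cases <;> simp
        map_smul' := fun a x => by ext i; cases i using Fin.cases <;> simp }
    refine hext _ (fgShortComplex_shortExact f (LinearMap.proj 0) ?_ ?_ ?_) ih hR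
    · intro x
      refine ⟨fun h => ⟨fun i => x i.succ, ?_⟩, ?_⟩
      · ext i
        cases i using Fin.cases
        · exact Eq.symm h
        · rfl
      · rintro ⟨y, rfl⟩; rfl
    · intro x y h
      exact Fin.cons_right_injective (α := fun _ => R) 0 h
    · intro x
      exact ⟨fun _ => x, rfl⟩

lemma Filt.of_linearEquiv {P : ObjectProperty (FGModuleCat.{u} R)} {M N : Type u}
    [AddCommGroup M] [AddCommGroup N] [Module R M] [Module R N] [Module.Finite R M]
    [Module.Finite R N] (e : M ≃ₗ[R] N) (h : Filt P (FGModuleCat.of R M)) :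
    Filt P (FGModuleCat.of R N) := .of_iso e.toFGModuleCatIso h

/-- A nonzero finitely generated module supported on `V(I)` has a filtration by modules `R/𝔭` with
`𝔭 ∈ V(I)`. -/
lemma filt_cyclicPrimes (I : Ideal R) (M : Type u) [AddCommGroup M] [Module R M]
    [Module.Finite R M] (hM : I ≤ (Module.annihilator R M).radical) :
    Subsingleton M ∨ Filt (cyclicPrimes I) (FGModuleCat.of R M) := by
  induction ‹Module.Finite R M› using
    IsNoetherianRing.induction_on_isQuotientEquivQuotientPrime R with
  | subsingleton N => exact Or.inl ‹_›
  | quotient N p e =>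
    refine Or.inr (.of_mem ⟨p, ?_, ⟨e.toFGModuleCatIso⟩⟩)
    rwa [LinearEquiv.annihilator_eq e, Ideal.annihilator_quotient, p.2.radical] at hM
  | exact N₁ N₂ N₃ f g hf hg hfg h₁ h₃ =>
    have H₁ := h₁ (hM.trans (Ideal.radical_mono (f.annihilator_le_of_injective hf)))
    have H₃ := h₃ (hM.trans (Ideal.radical_mono (g.annihilator_le_of_surjective hg)))
    -- `Filt` of the modules R/𝔭 contains no zero module, so zero outer terms are treated apart: the
    -- other map is then an isomorphism.
    obtain H₁ | H₁ := H₁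
    · have hg' : Function.Injective g := by
        rw [← LinearMap.ker_eq_bot, hfg.linearMap_ker_eq, LinearMap.range_eq_bot]
        exact Subsingleton.elim _ _
      let e := LinearEquiv.ofBijective g ⟨hg', hg⟩
      obtain H₃ | H₃ := H₃
      · exact Or.inl e.injective.subsingleton
      · exact Or.inr (H₃.of_linearEquiv e.symm)
    · obtain H₃ | H₃ := H₃
      · have hf' : Function.Surjective f := by
          rw [← LinearMap.range_eq_top, ← hfg.linearMap_ker_eq, LinearMap.ker_eq_top]
          exact Subsingleton.elim _ _
        exact Or.inr (H₁.of_linearEquiv (LinearEquiv.ofBijective f ⟨hf, hf'⟩))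
      · exact Or.inr (.extension _ (fgShortComplex_shortExact f g hfg hf hg) H₁ H₃)

end FG

/-! ### Modules in the derived category, and Rees' theorem -/

section SingleFunctor

open DerivedCategory

variable {A : Type*} [Category* A] [Abelian A] [HasDerivedCategory A]

lemma homVanish_single_zero (T N : A) :
    HomVanish ((singleFunctor A 0).obj T) ((singleFunctor A 0).obj N) 0 := fun i hi f => by
  have := TStructure.t.isGE_shift ((singleFunctor A 0).obj N) 0 i (-i)
  exact TStructure.t.zero f 0 (-i)

lemma single_hom_shift_eq_zero_of_projective (P N : A) [Projective P] {i : ℤ} (hi : 0 < i)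
    (f : (singleFunctor A 0).obj P ⟶ ((singleFunctor A 0).obj N)⟦i⟧) : f = 0 := by
  rw [← cancel_mono (((singleFunctors A).shiftIso i (-i) 0 (by lia)).hom.app _), zero_comp]
  exact from_singleFunctor_obj_eq_zero_of_projective
    (L := (CochainComplex.singleFunctor A (-i)).obj N) _ (-i) (by lia)

end SingleFunctor

section Grade

open scoped Pointwise

open DerivedCategory

variable {R : Type u} [CommRing R] [IsNoetherianRing R]

/-- Rees' theorem: if the elements of a weakly `N`-regular sequence act nilpotently on `T`, then
`Ext^i(T, N) = 0` for all `i` less than the length of the sequence. -/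
lemma homVanish_of_isWeaklyRegular (T : FGModuleCat.{u} R) (rs : List R)
    (hT : ∀ r ∈ rs, ∃ k : ℕ, r ^ k • 𝟙 T = 0) (N : Type u) [AddCommGroup N] [Module R N]
    [Module.Finite R N] (hN : RingTheory.Sequence.IsWeaklyRegular N rs) :
    HomVanish ((singleFunctor (FGModuleCat.{u} R) 0).obj T)
      ((singleFunctor (FGModuleCat.{u} R) 0).obj (FGModuleCat.of R N)) rs.length := by
  induction rs generalizing N with
  | nil => exact homVanish_single_zero _ _
  | cons r rs ih =>
    rw [RingTheory.Sequence.isWeaklyRegular_cons_iff] at hN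
    have h1 := ih (fun r hr => hT r (by simp [hr])) _ hN.2
    obtain ⟨k, hk⟩ := hT r (by simp)
    -- By regularity the cone of r on N is N/rN, to which the induction hypothesis applies.
    have hS := fgShortComplex_shortExact (LinearMap.lsmul R N r) (r • ⊤ : Submodule R N).mkQ
      (by
        rw [LinearMap.exact_iff, Submodule.ker_mkQ]
        ext x
        simp [Submodule.mem_smul_pointwise_iff_exists]) hN.1 (Submodule.mkQ_surjective _)
    have e : (singleFunctor (FGModuleCat.{u} R) 0).map (FGModuleCat.ofHom (LinearMap.lsmul R N r)) =
        r • 𝟙 ((singleFunctor (FGModuleCat.{u} R) 0).obj (FGModuleCat.of R N)) := by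
      rw [← CategoryTheory.Functor.map_id, ← Functor.map_smul]
      rfl
    have hD := hS.singleTriangle_distinguished
    dsimp only [ShortComplex.ShortExact.singleTriangle] at hD
    rw [e] at hD
    refine HomVanish.of_cone_smul (y := r) (k := k) hD (h1.mono (by simp)) ?_
    rw [← CategoryTheory.Functor.map_id, ← Functor.map_smul, hk, Functor.map_zero]

/-- Vanishing of morphisms into `R` implies vanishing of morphisms into free modules. -/
lemma HomVanish.free {T : DerivedCategory (FGModuleCat.{u} R)} {c : ℤ}
    (h : HomVanish T ((singleFunctor (FGModuleCat.{u} R) 0).obj (FGModuleCat.of R R)) c) (n : ℕ) :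
    HomVanish T ((singleFunctor (FGModuleCat.{u} R) 0).obj (FGModuleCat.of R (Fin n → R))) c := by
  refine prop_free (P := fun M => HomVanish T ((singleFunctor (FGModuleCat.{u} R) 0).obj M) c)
    (fun (M : FGModuleCat.{u} R) hM i hi f => ?_) h
    (fun S hS h₁ h₃ => HomVanish.obj₂ hS.singleTriangle_distinguished h₁ h₃) n
  exact ((shiftFunctor _ i).map_isZero
    ((singleFunctor _ 0).map_isZero (isZero_of_subsingleton M hM))).eq_of_tgt _ _

end Grade

/-- A distinguished triangle whose objects and first two morphisms lie in a triangulated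
subcategory comes from a distinguished triangle in the subcategory. -/
lemma exists_distinguished_of_ι {C : Type*} [Category* C] [HasZeroObject C] [HasShift C ℤ]
    [Preadditive C] [∀ n : ℤ, (shiftFunctor C n).Additive] [Pretriangulated C]
    (P : ObjectProperty C) [P.IsTriangulated] {X Y Z : P.FullSubcategory} (f : X ⟶ Y) (g : Y ⟶ Z)
    (h : P.ι.obj Z ⟶ (P.ι.obj X)⟦(1 : ℤ)⟧)
    (hT : Triangle.mk (P.ι.map f) (P.ι.map g) h ∈ distTriang C) :
    ∃ h' : Z ⟶ X⟦(1 : ℤ)⟧, Triangle.mk f g h' ∈ distTriang P.FullSubcategory :=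
  ⟨P.fullyFaithfulι.preimage (h ≫ (P.ι.commShiftIso (1 : ℤ)).inv.app X),
    isomorphic_distinguished _ hT _
      (Triangle.isoMk _ _ (Iso.refl _) (Iso.refl _) (Iso.refl _)
        ((Category.comp_id _).trans (Category.id_comp _).symm)
        ((Category.comp_id _).trans (Category.id_comp _).symm) (by
          change (P.ι.map (P.fullyFaithfulι.preimage (h ≫ (P.ι.commShiftIso (1 : ℤ)).inv.app X)) ≫
            (P.ι.commShiftIso (1 : ℤ)).hom.app X) ≫ (𝟙 (P.ι.obj X))⟦(1 : ℤ)⟧' = 𝟙 (P.ι.obj Z) ≫ h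
          simp))⟩

/-! ### The bounded derived category and perfect complexes -/

section Bounded
variable (R : Type u) [CommRing R] [IsNoetherianRing R]

open DerivedCategory

/-- The inclusion of the bounded derived category into the derived category. -/
noncomputable abbrev incl : Db R ⥤ DerivedCategory (FGModuleCat.{u} R) :=
  (TStructure.t (C := FGModuleCat.{u} R)).bounded.ι

scoped instance shiftFunctor_Db_linear (n : ℤ) : (shiftFunctor (Db R) n).Linear R where
  map_smul f r := by
    apply (incl R).map_injective
    rw [Functor.map_smul (incl R), ← cancel_mono (((incl R).commShiftIso n).hom.app _),
      Functor.commShiftIso_hom_naturality, Linear.smul_comp, Functor.commShiftIso_hom_naturality,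
      Functor.map_smul (incl R), Functor.map_smul (shiftFunctor _ n), Linear.comp_smul]

scoped instance toDb_linear : (toDb R).Linear R where
  map_smul f r := (incl R).map_injective
    ((Functor.map_smul (singleFunctor (FGModuleCat.{u} R) 0) r f).trans
      (Functor.map_smul (incl R) r ((toDb R).map f)).symm)

scoped instance toDb_additive : (toDb R).Additive where
  map_add {_ _ f g} := (incl R).map_injective
    ((Functor.map_add (singleFunctor (FGModuleCat.{u} R) 0)).trans
      (Functor.map_add (incl R) (f := (toDb R).map f) (g := (toDb R).map g)).symm)

scoped instance toDb_full : (toDb R).Full where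
  map_surjective f := by
    obtain ⟨g, hg⟩ := (singleFunctor (FGModuleCat.{u} R) 0).map_surjective ((incl R).map f)
    exact ⟨g, (incl R).map_injective hg⟩

scoped instance toDsg_linear : (toDsg R).Linear R := by
  delta toDsg; infer_instance

scoped instance toDsg_additive : (toDsg R).Additive := by
  delta toDsg; infer_instance

variable {R}

/-- A short exact sequence of modules induces a distinguished triangle in the bounded derived
category. -/
lemma exists_toDb_triangle {S : ShortComplex (FGModuleCat.{u} R)} (hS : S.ShortExact) :
    ∃ δ : (toDb R).obj S.X₃ ⟶ ((toDb R).obj S.X₁)⟦(1 : ℤ)⟧,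
      Triangle.mk ((toDb R).map S.f) ((toDb R).map S.g) δ ∈ distTriang (Db R) := by
  exact exists_distinguished_of_ι _ ((toDb R).map S.f) ((toDb R).map S.g) hS.singleδ
    hS.singleTriangle_distinguished

lemma toDb_hom_shift_eq_zero_of_projective (P N : FGModuleCat.{u} R) [Projective P] {i : ℤ}
    (hi : 0 < i) (f : (toDb R).obj P ⟶ ((toDb R).obj N)⟦i⟧) : f = 0 := by
  apply (incl R).map_injective
  rw [← cancel_mono (((incl R).commShiftIso i).hom.app _), Functor.map_zero, zero_comp]
  exact single_hom_shift_eq_zero_of_projective P N hi _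

end Bounded

section Perfect

open ZeroObject
variable (R : Type u) [CommRing R] [IsNoetherianRing R]

/-- The objects of the bounded derived category which admit no nonzero morphisms to modules placed
in sufficiently small cohomological degrees. -/
def eventuallyOrthogonal : ObjectProperty (Db R) := fun P =>
  ∃ n : ℤ, ∀ i, n ≤ i → ∀ (L : FGModuleCat.{u} R) (f : P ⟶ ((toDb R).obj L)⟦i⟧), f = 0

scoped instance : (eventuallyOrthogonal R).IsStableUnderRetracts where
  of_retract := by
    rintro P Q r ⟨n, hn⟩
    refine ⟨n, fun i hi L f => ?_⟩
    rw [show f = r.i ≫ r.r ≫ f by rw [← Category.assoc, r.retract, Category.id_comp],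
      hn i hi L (r.r ≫ f), comp_zero]

scoped instance : (eventuallyOrthogonal R).IsTriangulated where
  exists_zero := ⟨0, isZero_zero (Db R), 0, fun i hi L f => (isZero_zero _).eq_of_src _ _⟩
  isStableUnderShiftBy a := ⟨by
    rintro P ⟨n, hn⟩
    refine ⟨n + a, fun i hi L f => ?_⟩
    have h1 := hn (i - a) (by lia) L ((shiftShiftNeg P a).inv ≫ f⟦-a⟧' ≫
      (shiftFunctorAdd' (Db R) i (-a) (i - a) (by lia)).inv.app _)
    have h2 : f⟦-a⟧' = 0 := by
      rwa [← cancel_epi (shiftShiftNeg P a).inv,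
        ← cancel_mono ((shiftFunctorAdd' (Db R) i (-a) (i - a) (by lia)).inv.app _),
        Category.assoc, comp_zero, zero_comp]
    exact (shiftFunctor (Db R) (-a)).map_injective (by simpa using h2)⟩
  toIsTriangulatedClosed₂ := .mk' (by
    rintro T hT ⟨n, hn⟩ ⟨m, hm⟩
    refine ⟨max n m, fun i hi L f => ?_⟩
    obtain ⟨g, hg⟩ := Triangle.yoneda_exact₂ T hT f (hn i (le_of_max_le_left hi) L _)
    rw [hg, hm i (le_of_max_le_right hi) L g, comp_zero])

/-- Positive Ext out of R vanishes, and the bound may vary with the object, so the condition is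
thick. It allows maps out of a perfect cone to be killed by passing to a high syzygy of the target.
-/
lemma perfect_le_eventuallyOrthogonal : perfect R ≤ eventuallyOrthogonal R := by
  rw [ObjectProperty.triangEnvelope_le_iff]
  rintro _ ⟨⟩
  exact ⟨1, fun i hi L f => toDb_hom_shift_eq_zero_of_projective _ L (by lia) f⟩

lemma perfect_free (n : ℕ) : perfect R ((toDb R).obj (FGModuleCat.of R (Fin n → R))) := by
  refine prop_free (P := fun M => perfect R ((toDb R).obj M)) (fun (M : FGModuleCat.{u} R) hM => ?_)
    (ObjectProperty.le_triangEnvelope _ _ ⟨()⟩) (fun S hS h₁ h₃ => ?_) n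
  · exact (perfect R).prop_of_isZero ((toDb R).map_isZero (isZero_of_subsingleton M hM))
  · obtain ⟨δ, hδ⟩ := exists_toDb_triangle hS
    exact (perfect R).ext_of_isTriangulatedClosed₂ _ hδ h₁ h₃

end Perfect

/-! ### The Spanier–Whitehead category is triangulated -/

section Resolving
variable {R : Type u} [CommRing R] [IsNoetherianRing R] {X : ObjectProperty (FGModuleCat.{u} R)}

lemma IsResolving.of_subsingleton (hX : IsResolving X) (M : FGModuleCat.{u} R)
    (hM : Subsingleton M) : X M := by
  refine hX.summand ⟨⟨0, 0, ?_⟩⟩ hX.self_mem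
  ext x
  exact Subsingleton.elim (α := M) _ _

lemma IsResolving.free (hX : IsResolving X) (n : ℕ) : X (FGModuleCat.of R (Fin n → R)) :=
  prop_free hX.of_subsingleton hX.self_mem hX.extension n

/-- A syzygy of a module in a resolving subcategory, together with the connecting morphism in the
bounded derived category. -/
lemma IsResolving.exists_syzygy (hX : IsResolving X) {M : FGModuleCat.{u} R} (hM : X M) :
    ∃ (n : ℕ) (K : FGModuleCat.{u} R) (_ : X K)
      (i : (toDb R).obj K ⟶ (toDb R).obj (FGModuleCat.of R (Fin n → R)))
      (p : (toDb R).obj (FGModuleCat.of R (Fin n → R)) ⟶ (toDb R).obj M)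
      (δ : (toDb R).obj M ⟶ ((toDb R).obj K)⟦(1 : ℤ)⟧),
      Triangle.mk i p δ ∈ distTriang (Db R) := by
  obtain ⟨n, K, i, p, w, h⟩ := SpanierWhitehead.exists_syzygy M
  obtain ⟨δ, hδ⟩ := exists_toDb_triangle h
  exact ⟨n, K, hX.kernel _ h (hX.free n) hM, _, _, δ, hδ⟩

lemma trW_of_free_triangle {n : ℕ} {K M : Db R}
    {i : K ⟶ (toDb R).obj (FGModuleCat.of R (Fin n → R))}
    {p : (toDb R).obj (FGModuleCat.of R (Fin n → R)) ⟶ M} {δ : M ⟶ K⟦(1 : ℤ)⟧}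
    (h : Triangle.mk i p δ ∈ distTriang (Db R)) : (perfect R).trW δ :=
  ObjectProperty.trW.mk' _ (rot_of_distTriang _ h) (perfect_free R n)

/-- Every module in a resolving subcategory is isomorphic, modulo perfect complexes, to an arbitrarily
high shift of a module in that subcategory. -/
lemma IsResolving.exists_trW_shift (hX : IsResolving X) (j : ℕ) {M : FGModuleCat.{u} R}
    (hM : X M) : ∃ (L : FGModuleCat.{u} R) (_ : X L)
      (d : (toDb R).obj M ⟶ ((toDb R).obj L)⟦(j : ℤ)⟧), (perfect R).trW d := by
  induction j with
  | zero =>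
    exact ⟨M, hM, (shiftFunctorZero (Db R) ℤ).inv.app _,
      (perfect R).trW_of_isIso ((shiftFunctorZero (Db R) ℤ).inv.app ((toDb R).obj M))⟩
  | succ j ih =>
    obtain ⟨L, hL, d, hd⟩ := ih
    obtain ⟨n, K, hK, i, p, δ, h⟩ := hX.exists_syzygy hL
    refine ⟨K, hK, d ≫ δ⟦(j : ℤ)⟧' ≫
      (shiftFunctorAdd' (Db R) 1 (j : ℤ) ((j + 1 : ℕ) : ℤ) (by push_cast; ring)).inv.app _,
      MorphismProperty.comp_mem _ _ _ hd (MorphismProperty.comp_mem _ _ _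
        ((trW_of_free_triangle h).shift _) ((perfect R).trW_of_isIso _))⟩

scoped instance : (SW X).IsClosedUnderIsomorphisms where
  of_iso := by
    rintro Y Z e ⟨M, m, hM, ⟨f⟩⟩
    exact ⟨M, m, hM, ⟨e.symm ≪≫ f⟩⟩

scoped instance : (SW X).IsStableUnderShift ℤ where
  isStableUnderShiftBy a := ⟨by
    rintro Y ⟨M, m, hM, ⟨f⟩⟩
    exact ⟨M, m + a, hM, ⟨(shiftFunctor _ a).mapIso f ≪≫ ((shiftFunctorAdd _ m a).symm.app _)⟩⟩⟩

lemma SW_of_mem {M : FGModuleCat.{u} R} (hM : X M) : SW X ((toDsg R).obj M) :=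
  ⟨M, 0, hM, ⟨((shiftFunctorZero _ ℤ).symm.app _)⟩⟩

lemma trW_Q_comp_left_iff {Y Z T : Db R} {s : Y ⟶ Z} (hs : (perfect R).trW s) (g : Z ⟶ T) :
    (SW X).trW ((perfect R).trW.Q.map (s ≫ g)) ↔ (SW X).trW ((perfect R).trW.Q.map g) := by
  have := Localization.inverts (perfect R).trW.Q (perfect R).trW s hs
  rw [Functor.map_comp]
  exact MorphismProperty.cancel_left_of_respectsIso (SW X).trW _ _

lemma trW_Q_comp_right_iff {Y Z T : Db R} (g : Y ⟶ Z) {s : Z ⟶ T} (hs : (perfect R).trW s) :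
    (SW X).trW ((perfect R).trW.Q.map (g ≫ s)) ↔ (SW X).trW ((perfect R).trW.Q.map g) := by
  have := Localization.inverts (perfect R).trW.Q (perfect R).trW s hs
  rw [Functor.map_comp]
  exact MorphismProperty.cancel_right_of_respectsIso (SW X).trW _ _

lemma trW_Q_shift {Y Z : Db R} {g : Y ⟶ Z} (hg : (SW X).trW ((perfect R).trW.Q.map g)) (n : ℤ) :
    (SW X).trW ((perfect R).trW.Q.map (g⟦n⟧')) := by
  refine (MorphismProperty.cancel_right_of_respectsIso (SW X).trW _
    (((perfect R).trW.Q.commShiftIso n).hom.app _)).1 ?_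
  rw [Functor.commShiftIso_hom_naturality]
  exact (MorphismProperty.cancel_left_of_respectsIso (SW X).trW _ _).2 (hg.shift n)

lemma Q_map_distinguished {T : Triangle (Db R)} (hT : T ∈ distTriang (Db R)) :
    (perfect R).trW.Q.mapTriangle.obj T ∈ distTriang (Dsg R) :=
  (perfect R).trW.Q.map_distinguished T hT

lemma IsResolving.prod_free (hX : IsResolving X) {M : FGModuleCat.{u} R} (hM : X M) (n : ℕ) :
    X (FGModuleCat.of R (M × (Fin n → R))) :=
  hX.extension _ (fgShortComplex_shortExact (LinearMap.inl R M (Fin n → R)) (LinearMap.snd R M _)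
    Function.Exact.inl_snd LinearMap.inl_injective LinearMap.snd_surjective) hM (hX.free n)

/-- Adding a free cover of L to M does not change M modulo perfect complexes and makes h surjective.
The kernel is then in X, and it is the cone up to shift. -/
lemma IsResolving.trW_map (hX : IsResolving X) {M L : FGModuleCat.{u} R} (hM : X M) (hL : X L)
    (h : M ⟶ L) : (SW X).trW ((perfect R).trW.Q.map ((toDb R).map h)) := by
  obtain ⟨n, π, hπ⟩ := Module.Finite.exists_fin' R L
  let φ : (M × (Fin n → R)) →ₗ[R] L := h.hom.hom.coprod π
  have hφ : Function.Surjective φ := fun x => by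
    obtain ⟨y, rfl⟩ := hπ x
    exact ⟨(0, y), by simp [φ]⟩
  have H₁ := fgShortComplex_shortExact _ φ (LinearMap.exact_subtype_ker_map φ)
    (Submodule.injective_subtype _) hφ
  have H₂ := fgShortComplex_shortExact (LinearMap.inl R M (Fin n → R)) (LinearMap.snd R M _)
    Function.Exact.inl_snd LinearMap.inl_injective LinearMap.snd_surjective
  obtain ⟨δ₁, h₁⟩ := exists_toDb_triangle H₁
  obtain ⟨δ₂, h₂⟩ := exists_toDb_triangle H₂
  have e : h = (FGModuleCat.ofHom (LinearMap.inl R M (Fin n → R)) :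
      M ⟶ FGModuleCat.of R (M × (Fin n → R))) ≫ (FGModuleCat.ofHom φ :
        FGModuleCat.of R (M × (Fin n → R)) ⟶ L) := by
    ext x
    exact (by simp [φ] : h.hom.hom x = φ (LinearMap.inl R M (Fin n → R) x))
  rw [e, Functor.map_comp]
  refine (trW_Q_comp_left_iff (ObjectProperty.trW.mk _ h₂ (perfect_free R n)) _).2 ?_
  exact ObjectProperty.trW.mk' (SW X) (Q_map_distinguished h₁)
    (SW_of_mem (hX.kernel _ H₁ (hX.prod_free hM n) hL))

/-- Dimension shifting: positive Ext out of a free module vanishes, so g factors through the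
connecting morphism from M to its shifted syzygy, invertible modulo perfect complexes. After n
rounds a module homomorphism remains. -/
lemma IsResolving.trW_hom_shift (hX : IsResolving X) (n : ℕ) {M L : FGModuleCat.{u} R} (hM : X M)
    (hL : X L) (g : (toDb R).obj M ⟶ ((toDb R).obj L)⟦(n : ℤ)⟧) :
    (SW X).trW ((perfect R).trW.Q.map g) := by
  induction n generalizing M with
  | zero =>
    obtain ⟨h, hh⟩ := (toDb R).map_surjective (g ≫ (shiftFunctorZero (Db R) ℤ).hom.app _)
    refine (trW_Q_comp_right_iff g (s := (shiftFunctorZero (Db R) ℤ).hom.app _)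
      ((perfect R).trW_of_isIso _)).1 ?_
    exact hh ▸ hX.trW_map hM hL h
  | succ n ih =>
    obtain ⟨m, K, hK, i, p, δ, h⟩ := hX.exists_syzygy hM
    obtain ⟨g₁, rfl⟩ := Triangle.yoneda_exact₃ _ h g
      (toDb_hom_shift_eq_zero_of_projective _ L (by lia) _)
    refine (trW_Q_comp_left_iff (trW_of_free_triangle h) _).2 ?_
    let e := shiftFunctorAdd' (Db R) (n : ℤ) 1 ((n + 1 : ℕ) : ℤ) (by push_cast; ring)
    obtain ⟨g₀, hg₀⟩ := (shiftFunctor (Db R) (1 : ℤ)).map_surjective (g₁ ≫ e.hom.app _)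
    refine (trW_Q_comp_right_iff g₁ (s := e.hom.app _) ((perfect R).trW_of_isIso _)).1 ?_
    exact hg₀ ▸ trW_Q_shift (ih hK g₀) 1

/-- Write f as a fraction whose denominator has perfect cone. Once N is replaced by a high enough
syzygy, the numerator vanishes on that cone and extends over the denominator to a morphism in the
bounded derived category. -/
lemma IsResolving.trW_of_hom_Q (hX : IsResolving X) {M N : FGModuleCat.{u} R} (hM : X M)
    (hN : X N) (c : ℤ) (f : (toDsg R).obj M ⟶ (perfect R).trW.Q.obj (((toDb R).obj N)⟦c⟧)) :
    (SW X).trW f := by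
  obtain ⟨φ, hφ⟩ := Localization.exists_rightFraction (perfect R).trW.Q (perfect R).trW f
  have hs := Localization.inverts (perfect R).trW.Q (perfect R).trW _ φ.hs
  obtain ⟨P, a, b, hT, hP⟩ := ((perfect R).trW_iff' _).1 φ.hs
  obtain ⟨n₀, hn₀⟩ := perfect_le_eventuallyOrthogonal R _ hP
  -- j + c must reach n₀, so that maps out of P vanish, and be nonnegative, so that dimension
  -- shifting applies.
  obtain ⟨j, hj₁⟩ : ∃ j : ℕ, max (n₀ - c) (-c) ≤ j := ⟨_, Int.self_le_toNat _⟩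
  obtain ⟨L, hL, d, hd⟩ := hX.exists_trW_shift j hN
  have hj : (j : ℤ) + c = ((j + c).toNat : ℤ) := by lia
  let e := shiftFunctorAdd' (Db R) (j : ℤ) c ((j + c).toNat : ℤ) hj
  have he : (perfect R).trW (d⟦c⟧' ≫ e.inv.app _) :=
    MorphismProperty.comp_mem _ _ _ (hd.shift c) ((perfect R).trW_of_isIso _)
  obtain ⟨g, hg⟩ := Triangle.yoneda_exact₂ _ hT (φ.f ≫ d⟦c⟧' ≫ e.inv.app _)
    (hn₀ _ (by lia) L _)
  have hs' := Localization.inverts (perfect R).trW.Q (perfect R).trW _ he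
  refine (MorphismProperty.cancel_right_of_respectsIso (SW X).trW f
    ((perfect R).trW.Q.map (d⟦c⟧' ≫ e.inv.app _))).1 ?_
  refine (MorphismProperty.cancel_left_of_respectsIso (SW X).trW
    ((perfect R).trW.Q.map φ.s) _).1 ?_
  have : (perfect R).trW.Q.map φ.s ≫ f ≫ (perfect R).trW.Q.map (d⟦c⟧' ≫ e.inv.app _) =
      (perfect R).trW.Q.map φ.s ≫ (perfect R).trW.Q.map g := by
    rw [hφ, MorphismProperty.RightFraction.map_s_comp_map_assoc, ← Functor.map_comp]
    exact (congrArg _ hg).trans (Functor.map_comp _ _ _)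
  exact (congrArg (fun t => (SW X).trW t) this).mpr
    ((MorphismProperty.cancel_left_of_respectsIso (SW X).trW _ _).2 (hX.trW_hom_shift _ hM hL g))

lemma IsResolving.trW_of_SW (hX : IsResolving X) {A B : Dsg R} (hA : SW X A) (hB : SW X B)
    (f : A ⟶ B) : (SW X).trW f := by
  obtain ⟨M, m, hM, ⟨a⟩⟩ := hA
  obtain ⟨N, n, hN, ⟨b⟩⟩ := hB
  let e := shiftFunctorAdd' (Dsg R) (n - m) m n (by lia)
  obtain ⟨g, hg⟩ := (shiftFunctor (Dsg R) m).map_surjective (a.inv ≫ f ≫ b.hom ≫ e.hom.app _)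
  let e' : (perfect R).trW.Q.obj (((toDb R).obj N)⟦n - m⟧) ≅ ((toDsg R).obj N)⟦n - m⟧ :=
    ((perfect R).trW.Q.commShiftIso (n - m)).app ((toDb R).obj N)
  have h₁ := (MorphismProperty.cancel_right_of_respectsIso (SW X).trW g e'.inv).1
    (hX.trW_of_hom_Q hM hN (n - m) (g ≫ e'.inv))
  have h₂ := h₁.shift m
  rw [hg] at h₂
  have h₃ := (MorphismProperty.cancel_left_of_respectsIso (SW X).trW _ _).1 h₂
  rw [← Category.assoc] at h₃
  exact (MorphismProperty.cancel_right_of_respectsIso (SW X).trW _ _).1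
    ((MorphismProperty.cancel_right_of_respectsIso (SW X).trW _ _).1 h₃)

lemma IsResolving.isTriangulated_SW (hX : IsResolving X) : (SW X).IsTriangulated where
  exists_zero := by
    refine ⟨(toDsg R).obj (FGModuleCat.of R PUnit), 
      (toDsg R).map_isZero (isZero_of_subsingleton _ inferInstance),
      SW_of_mem (hX.of_subsingleton _ inferInstance)⟩
  toIsTriangulatedClosed₂ := .mk' fun T hT h₁ h₃ => by
    -- Up to shift, the middle term is the cone of the connecting morphism.
    have h := hX.trW_of_SW h₃ ((SW X).le_shift 1 _ h₁) T.mor₃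
    exact ((SW X).prop_shift_iff_of_isStableUnderShift _ _).1 (((SW X).trW_iff_of_distinguished _
      (rot_of_distTriang _ (rot_of_distTriang _ hT))).1 h)

end Resolving

/-! ### Annihilators in the singularity category -/

section Localization

open ZeroObject
variable {R : Type u} [CommRing R] [IsNoetherianRing R]

lemma isZero_Q_obj {P : Db R} (hP : perfect R P) : IsZero ((perfect R).trW.Q.obj P) := by
  have h : (perfect R).trW (0 : (0 : Db R) ⟶ P) :=
    ⟨_, _, _, contractible_distinguished₁ P, hP⟩
  have := Localization.inverts (perfect R).trW.Q (perfect R).trW _ h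
  exact ((perfect R).trW.Q.map_isZero (isZero_zero _)).of_iso
    (asIso ((perfect R).trW.Q.map (0 : (0 : Db R) ⟶ P))).symm

lemma isZero_toDsg_free (n : ℕ) : IsZero ((toDsg R).obj (FGModuleCat.of R (Fin n → R))) :=
  isZero_Q_obj (perfect_free R n)

lemma nonempty_iso_shift_of_free_triangle {n : ℕ} {K M : Db R}
    {i : K ⟶ (toDb R).obj (FGModuleCat.of R (Fin n → R))}
    {p : (toDb R).obj (FGModuleCat.of R (Fin n → R)) ⟶ M} {δ : M ⟶ K⟦(1 : ℤ)⟧}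
    (h : Triangle.mk i p δ ∈ distTriang (Db R)) :
    Nonempty ((perfect R).trW.Q.obj M ≅ ((perfect R).trW.Q.obj K)⟦(1 : ℤ)⟧) := by
  have := Localization.inverts (perfect R).trW.Q (perfect R).trW _ (trW_of_free_triangle h)
  exact ⟨asIso ((perfect R).trW.Q.map δ) ≪≫ ((perfect R).trW.Q.commShiftIso (1 : ℤ)).app K⟩

variable (M : Type u) [AddCommGroup M] [Module R M] [Module.Finite R M] (p : Ideal R) [p.IsPrime]

/-- A splitting of the localised free cover spreads out after clearing denominators: s makes it a
map from M to the free module, and t makes the splitting identity hold. Thus t * s factors through a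
free module. -/
lemma exists_notMem_smul_eq_zero_of_projective
    [Module.Projective (Localization.AtPrime p) (LocalizedModule p.primeCompl M)] :
    ∃ a ∉ p, a • 𝟙 ((toDsg R).obj (FGModuleCat.of R M)) = 0 := by
  obtain ⟨n, π, hπ⟩ := Module.Finite.exists_fin' R M
  obtain ⟨σ, hσ⟩ := Module.projective_lifting_property (LocalizedModule.map p.primeCompl π)
    LinearMap.id (LocalizedModule.map_surjective p.primeCompl π hπ)
  have : Module.FinitePresentation R M := Module.finitePresentation_of_finite R M
  obtain ⟨h, s, hs⟩ := Module.FinitePresentation.exists_lift_of_isLocalizedModule p.primeCompl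
    (LocalizedModule.mkLinearMap p.primeCompl (Fin n → R))
    (σ.restrictScalars R ∘ₗ LocalizedModule.mkLinearMap p.primeCompl M)
  obtain ⟨t, ht⟩ := Module.Finite.exists_smul_of_comp_eq_of_isLocalizedModule p.primeCompl
    (LocalizedModule.mkLinearMap p.primeCompl M) (π ∘ₗ h) (s • LinearMap.id) (by
      ext x
      have h₁ := congrArg (LocalizedModule.map p.primeCompl π) (LinearMap.congr_fun hs x)
      have h₂ := LinearMap.congr_fun hσ (LocalizedModule.mkLinearMap p.primeCompl M x)
      simp only [LinearMap.coe_comp, Function.comp_apply, LocalizedModule.mkLinearMap_apply,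
        LinearMap.smul_apply, LinearMap.coe_restrictScalars, Submonoid.smul_def, map_smul,
        LocalizedModule.map_mk, LinearMap.id_coe, id_eq] at h₁ h₂ ⊢
      exact h₁.trans ((map_smul ((LocalizedModule.map p.primeCompl π).restrictScalars R)
        (s : R) _).trans (congrArg _ h₂)))
  refine ⟨t * s, p.primeCompl.mul_mem t.2 s.2, ?_⟩
  have e : ((t : R) * s) • 𝟙 (FGModuleCat.of R M) =
      FGModuleCat.ofHom ((t : R) • h) ≫ FGModuleCat.ofHom π := by
    ext x
    have := LinearMap.congr_fun ht x
    exact (mul_smul (t : R) (s : R) (x : M)).trans (this.symm.trans (map_smul π (t : R) (h x)).symm)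
  rw [← (toDsg R).map_id, ← Functor.map_smul, e, Functor.map_comp,
    (isZero_toDsg_free n).eq_of_tgt ((toDsg R).map _) 0, zero_comp]

/-- A syzygy lowers the projective dimension and is only a shift in the singularity category, so the
same scalar serves. -/
lemma exists_notMem_smul_eq_zero_of_hasProjectiveDimensionLE (d : ℕ)
    (h : HasProjectiveDimensionLE (ModuleCat.of.{u} (Localization.AtPrime p)
      (LocalizedModule p.primeCompl M)) d) :
    ∃ a ∉ p, a • 𝟙 ((toDsg R).obj (FGModuleCat.of R M)) = 0 := by
  induction d generalizing M with
  | zero =>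
    rw [← projective_iff_hasProjectiveDimensionLE_zero, ← IsProjective.iff_projective] at h
    exact exists_notMem_smul_eq_zero_of_projective M p
  | succ d ih =>
    obtain ⟨n, π, hπ⟩ := Module.Finite.exists_fin' R M
    have hex := LinearMap.exact_subtype_ker_map π
    have hex' := LocalizedModule.map_exact p.primeCompl _ _ hex
    let S : ShortComplex (ModuleCat.{u} (Localization.AtPrime p)) :=
      ShortComplex.mk
        (X₁ := ModuleCat.of _ (LocalizedModule p.primeCompl (LinearMap.ker π)))
        (X₂ := ModuleCat.of _ (LocalizedModule p.primeCompl (Fin n → R)))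
        (X₃ := ModuleCat.of _ (LocalizedModule p.primeCompl M))
        (ModuleCat.ofHom (LocalizedModule.map p.primeCompl (LinearMap.ker π).subtype))
        (ModuleCat.ofHom (LocalizedModule.map p.primeCompl π)) (by
          ext1; exact LinearMap.ext fun x => hex'.apply_apply_eq_zero x)
    have hS : S.ShortExact :=
      { exact := (ShortComplex.ShortExact.moduleCat_exact_iff_function_exact S).2 hex'
        mono_f := (ModuleCat.mono_iff_injective _).2
          (LocalizedModule.map_injective p.primeCompl _ (Submodule.injective_subtype _))
        epi_g := (ModuleCat.epi_iff_surjective _).2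
          (LocalizedModule.map_surjective p.primeCompl _ hπ) }
    have h₂ : Projective S.X₂ := (IsProjective.iff_projective _).1 inferInstance
    obtain ⟨a, ha, ha'⟩ := ih (LinearMap.ker π) ((hS.hasProjectiveDimensionLT_X₃_iff _ h₂).1 h)
    obtain ⟨δ, hδ⟩ := exists_toDb_triangle
      (fgShortComplex_shortExact _ π hex (Submodule.injective_subtype _) hπ)
    obtain ⟨e⟩ := nonempty_iso_shift_of_free_triangle hδ
    exact ⟨a, ha, smul_id_eq_zero_of_iso e (smul_id_shift_eq_zero ha' 1)⟩

/-- If `x` is contained in all primes at which `M` has infinite projective dimension, then a power of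
`x` annihilates `M` in the singularity category. -/
lemma exists_pow_smul_eq_zero {x : R} (hx : ∀ q ∈ ipd (FGModuleCat.of R M), x ∈ q.asIdeal) :
    ∃ k : ℕ, x ^ k • 𝟙 ((toDsg R).obj (FGModuleCat.of R M)) = 0 := by
  let J : Ideal R := LinearMap.ker (LinearMap.toSpanSingleton R _
    (𝟙 ((toDsg R).obj (FGModuleCat.of R M))))
  -- Each prime containing the annihilator J must contain x: outside the locus it would miss an
  -- element of J.
  suffices h : x ∈ J.radical by
    obtain ⟨k, hk⟩ := h
    exact ⟨k, by simpa [J] using hk⟩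
  rw [Ideal.radical_eq_sInf, Ideal.mem_sInf]
  rintro q ⟨hJ, hq⟩
  by_cases h : (⟨q, hq⟩ : PrimeSpectrum R) ∈ ipd (FGModuleCat.of R M)
  · exact hx _ h
  · obtain ⟨d, hd⟩ := (projectiveDimension_ne_top_iff _).1 h
    obtain ⟨a, ha, ha'⟩ := exists_notMem_smul_eq_zero_of_hasProjectiveDimensionLE M q d hd
    exact absurd (hJ (by simpa [J] using ha')) ha

end Localization

/-! ### Balls, and balls inside a triangulated subcategory -/

section Balls

variable {C : Type u} [Category.{v} C] [HasZeroObject C] [HasShift C ℤ] [Preadditive C]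
  [∀ n : ℤ, (shiftFunctor C n).Additive] [Pretriangulated C] {P : ObjectProperty C}

lemma addClosure_of_retract {Y Z : C} (h : Retract Z Y) (hY : addClosure P Y) :
    addClosure P Z := by
  obtain ⟨n, F, hF, ⟨r⟩⟩ := hY
  exact ⟨n, F, hF, ⟨h.trans r⟩⟩

lemma addClosure_of_isZero {Z : C} (h : IsZero Z) : addClosure P Z :=
  ⟨0, nofun, nofun, ⟨⟨0, 0, h.eq_of_src _ _⟩⟩⟩

lemma le_addClosure : P ≤ addClosure P := fun Z hZ =>
  ⟨1, fun _ => Z, fun _ => hZ, ⟨⟨biproduct.ι (fun _ : Fin 1 => Z) 0, biproduct.π _ 0,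
    biproduct.ι_π_self _ _⟩⟩⟩

lemma le_angle : P ≤ angle P := (ObjectProperty.le_shiftClosure P).trans le_addClosure

scoped instance [P.IsStableUnderShift ℤ] : (addClosure P).IsStableUnderShift ℤ where
  isStableUnderShiftBy a := ⟨by
    rintro Z ⟨n, F, hF, ⟨r⟩⟩
    exact ⟨n, fun i => (F i)⟦a⟧, fun i => P.le_shift a _ (hF i),
      ⟨(r.map (shiftFunctor C a)).trans (.ofIso ((shiftFunctor C a).mapBiproduct F))⟩⟩⟩

scoped instance : (angle P).IsStableUnderShift ℤ :=
  inferInstanceAs ((addClosure (P.shiftClosure ℤ)).IsStableUnderShift ℤ)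

lemma ball_of_isZero {Z : C} (h : IsZero Z) : ∀ r, ball P r Z
  | 0 => h
  | 1 | _ + 2 => addClosure_of_isZero h

lemma ball_of_retract {Y Z : C} (h : Retract Z Y) : ∀ {r}, ball P r Y → ball P r Z
  | 0, hY => by
    rw [ball, IsZero.iff_id_eq_zero] at hY ⊢
    rw [← h.retract, ← Category.id_comp h.r, hY, zero_comp, comp_zero]
  | 1, hY | _ + 2, hY => addClosure_of_retract h hY

lemma ball_shift (a : ℤ) {Z : C} : ∀ {r}, ball P r Z → ball P r (Z⟦a⟧)
  | 0, hZ => (shiftFunctor C a).map_isZero hZ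
  | 1, hZ => (angle P).le_shift a _ hZ
  | _ + 2, hZ => (angle _).le_shift a _ hZ

lemma ball_of_triangle {T : Triangle C} (hT : T ∈ distTriang C) {r : ℕ}
    (h₁ : ball P (r + 1) T.obj₁) (h₃ : angle P T.obj₃) : ball P (r + 2) T.obj₂ :=
  le_angle _ ⟨_, _, _, _, _, hT, le_angle _ h₁, le_angle _ h₃⟩

lemma ball_mono {r s : ℕ} (h : r ≤ s) : ball P r ≤ ball P s := by
  induction h with
  | refl => exact le_rfl
  | @step s _ ih =>
    refine ih.trans fun Z hZ => ?_
    cases s with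
    | zero => exact ball_of_isZero hZ 1
    | succ s => exact ball_of_triangle (contractible_distinguished Z) hZ
                  (addClosure_of_isZero (isZero_zero C))

end Balls

section BallIn

variable {C : Type u} [Category.{v} C] [HasZeroObject C] [HasShift C ℤ] [Preadditive C]
  [∀ n : ℤ, (shiftFunctor C n).Additive] [Pretriangulated C] {P S : ObjectProperty C}
  [S.IsTriangulated] {r : ℕ}

variable (P S r) in
/-- The objects of a triangulated subcategory `S` in the ball of radius `r` centered at `P`, where the
ball is formed in `S`. -/
def ballIn : ObjectProperty C := fun Z =>
  ∃ h : S Z, ball (P.inverseImage S.ι) r ⟨Z, h⟩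

lemma ballIn.mono {s : ℕ} (h : r ≤ s) : ballIn P S r ≤ ballIn P S s :=
  fun _ ⟨hS, hZ⟩ => ⟨hS, ball_mono h _ hZ⟩

lemma ballIn.of_retract {Y Z : C} (hZ : S Z) (h : Retract Z Y) (hY : ballIn P S r Y) :
    ballIn P S r Z := by
  obtain ⟨hS, hY⟩ := hY
  refine ⟨hZ, ball_of_retract ⟨ObjectProperty.homMk h.i, ObjectProperty.homMk h.r, ?_⟩ hY⟩
  ext
  exact h.retract

lemma ballIn.shift [S.IsClosedUnderIsomorphisms] (a : ℤ) {Z : C} (hZ : ballIn P S r Z) :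
    ballIn P S r (Z⟦a⟧) := by
  obtain ⟨hS, hZ⟩ := hZ
  exact ⟨S.le_shift a _ hS, ball_of_retract (.ofIso (S.fullyFaithfulι.preimageIso
    (X := ⟨Z⟦a⟧, S.le_shift a _ hS⟩) (Y := (⟨Z, hS⟩ : S.FullSubcategory)⟦a⟧)
    ((S.ι.commShiftIso a).app ⟨Z, hS⟩).symm))
    (ball_shift a hZ)⟩

lemma ballIn_of_isZero [S.IsClosedUnderIsomorphisms] {Z : C} (hZ : IsZero Z) :
    ballIn P S r Z :=
  ⟨S.prop_of_isZero hZ, ball_of_isZero (by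
    rw [IsZero.iff_id_eq_zero]
    ext
    exact hZ.eq_of_src _ _) r⟩

lemma ballIn_of_mem (hPS : P ≤ S) {Z : C} (hZ : P Z) : ballIn P S 1 Z :=
  ⟨hPS _ hZ, le_angle _ hZ⟩

lemma ballIn.of_triangle [S.IsClosedUnderIsomorphisms] {T : Triangle C} (hT : T ∈ distTriang C)
    (h₁ : ballIn P S (r + 1) T.obj₁) (h₃ : ballIn P S 1 T.obj₃) : ballIn P S (r + 2) T.obj₂ := by
  obtain ⟨hS₁, h₁⟩ := h₁
  obtain ⟨hS₃, h₃⟩ := h₃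
  have hS₂ := S.ext_of_isTriangulatedClosed₂ _ hT hS₁ hS₃
  obtain ⟨δ, hδ⟩ := exists_distinguished_of_ι S (X := ⟨_, hS₁⟩) (Y := ⟨_, hS₂⟩) (Z := ⟨_, hS₃⟩)
    (ObjectProperty.homMk T.mor₁) (ObjectProperty.homMk T.mor₂) T.mor₃ hT
  exact ⟨hS₂, ball_of_triangle hδ h₁ h₃⟩

end BallIn

/-! ### Dévissage along cohomological degrees -/

section Devissage

open DerivedCategory

variable {R : Type u} [CommRing R] [IsNoetherianRing R]

lemma smul_id_eq_zero_of_iso_single {E : DerivedCategory (FGModuleCat.{u} R)}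
    {T : FGModuleCat.{u} R} {b : ℤ} (i : E ≅ (singleFunctor (FGModuleCat.{u} R) b).obj T) {x : R}
    (hx : x • 𝟙 E = 0) : x • 𝟙 T = 0 := by
  let j : (singleFunctor (FGModuleCat.{u} R) b).obj T ≅
      ((singleFunctor (FGModuleCat.{u} R) 0).obj T)⟦-b⟧ :=
    ((singleFunctors (FGModuleCat.{u} R)).shiftIso (-b) b 0 (by lia)).symm.app T
  apply (singleFunctor (FGModuleCat.{u} R) 0).map_injective
  have := smul_id_eq_zero_of_iso (i ≪≫ j).symm hx
  rw [smul_id_shift_eq_zero_iff] at this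
  simpa [Functor.map_smul] using this

lemma bounded_of_isGE_of_isLE {E : DerivedCategory (FGModuleCat.{u} R)} {a b : ℤ} (ha : E.IsGE a)
    (hb : E.IsLE b) : TStructure.t.bounded E := ⟨⟨a, ha⟩, ⟨b, hb⟩⟩

variable {P : ObjectProperty (FGModuleCat.{u} R)} {S : ObjectProperty (Dsg R)} [S.IsTriangulated]
  [S.IsClosedUnderIsomorphisms] {xs : List R}

/-- A complex killed by `xs` concentrated in one degree lies in the ball of radius `1` centered at the
modules killed by `xs`. -/
lemma ballIn_one_of_isGE_of_isLE (hPS : inDsg P ≤ S)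
    (hP : ∀ T : FGModuleCat.{u} R, (∀ x ∈ xs, x • 𝟙 T = 0) → IsZero T ∨ P T) (b : ℤ)
    (E : DerivedCategory (FGModuleCat.{u} R)) (hE : TStructure.t.bounded E) [E.IsLE b]
    [E.IsGE b] (hx : ∀ x ∈ xs, x • 𝟙 E = 0) :
    ballIn (inDsg P) S 1 ((perfect R).trW.Q.obj (⟨E, hE⟩ : Db R)) := by
  obtain ⟨T, ⟨i⟩⟩ := exists_iso_singleFunctor_obj_of_isGE_of_isLE E b
  let j : (singleFunctor (FGModuleCat.{u} R) b).obj T ≅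
      ((singleFunctor (FGModuleCat.{u} R) 0).obj T)⟦-b⟧ :=
    ((singleFunctors (FGModuleCat.{u} R)).shiftIso (-b) b 0 (by lia)).symm.app T
  let e : (⟨E, hE⟩ : Db R) ≅ ((toDb R).obj T)⟦-b⟧ :=
    ObjectProperty.isoMk _ (i ≪≫ j ≪≫ ((incl R).commShiftIso (-b)).symm.app ((toDb R).obj T))
  let e' : (perfect R).trW.Q.obj (⟨E, hE⟩ : Db R) ≅ ((toDsg R).obj T)⟦-b⟧ :=
    (perfect R).trW.Q.mapIso e ≪≫ ((perfect R).trW.Q.commShiftIso (-b)).app ((toDb R).obj T)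
  have h : ballIn (inDsg P) S 1 (((toDsg R).obj T)⟦-b⟧) := by
    obtain hT | hT := hP T fun x hx' => smul_id_eq_zero_of_iso_single i (hx x hx')
    · exact ballIn_of_isZero ((shiftFunctor _ _).map_isZero ((toDsg R).map_isZero hT))
    · exact (ballIn_of_mem hPS (P.prop_map_obj _ hT)).shift _
  exact h.of_retract (S.prop_of_iso e'.symm h.1) (.ofIso e')

/-- A bounded complex killed by `xs` with `m + 1` possibly nonzero cohomology modules lies in the
ball of radius `m + 1` centered at the modules killed by `xs`. -/
lemma ballIn_of_isGE_of_isLE (hPS : inDsg P ≤ S)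
    (hP : ∀ T : FGModuleCat.{u} R, (∀ x ∈ xs, x • 𝟙 T = 0) → IsZero T ∨ P T) (m : ℕ) (b : ℤ)
    (E : DerivedCategory (FGModuleCat.{u} R)) (hE : TStructure.t.bounded E) [E.IsLE b]
    [E.IsGE (b - m)] (hx : ∀ x ∈ xs, x • 𝟙 E = 0) :
    ballIn (inDsg P) S (m + 1) ((perfect R).trW.Q.obj (⟨E, hE⟩ : Db R)) := by
  induction m generalizing b E with
  | zero =>
    have : E.IsGE b := by simpa using ‹E.IsGE (b - (0 : ℕ))›
    exact ballIn_one_of_isGE_of_isLE hPS hP b E hE hx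
  | succ m ih =>
    -- Split off the top degree; the scalars still vanish on both truncations.
    let t : Triangulated.TStructure (DerivedCategory (FGModuleCat.{u} R)) := TStructure.t
    have h₁ : t.IsGE ((t.truncLE (b - 1)).obj E) (b - 1 - m) := by
      have : t.IsGE E (b - 1 - m) := t.isGE_of_ge E _ (b - (m + 1 : ℕ)) (by push_cast; lia)
      exact inferInstanceAs (t.IsGE ((t.truncLT (b - 1 + 1)).obj E) (b - 1 - m))
    have h₂ : t.IsLE ((t.truncGT (b - 1)).obj E) b :=
      inferInstanceAs (t.IsLE ((t.truncGE (b - 1 + 1)).obj E) b)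
    have h₃ : t.IsGE ((t.truncGT (b - 1)).obj E) b := inferInstance
    have hE₁ := bounded_of_isGE_of_isLE h₁
      (inferInstance : t.IsLE ((t.truncLE (b - 1)).obj E) (b - 1))
    have hE₃ := bounded_of_isGE_of_isLE h₃ h₂
    obtain ⟨δ, hδ⟩ := exists_distinguished_of_ι TStructure.t.bounded (X := ⟨_, hE₁⟩) (Y := ⟨E, hE⟩)
      (Z := ⟨_, hE₃⟩) (ObjectProperty.homMk ((t.truncLEι (b - 1)).app E))
      (ObjectProperty.homMk ((t.truncGTπ (b - 1)).app E)) _ (t.triangleLEGT_distinguished (b - 1) E)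
    exact ballIn.of_triangle (Q_map_distinguished hδ)
      (ih (b - 1) _ hE₁ fun x hx' => smul_id_truncLE_eq_zero t (hx x hx') _)
      (ballIn_one_of_isGE_of_isLE hPS hP b _ hE₃ fun x hx' => smul_id_truncGT_eq_zero t (hx x hx') _)

end Devissage

/-! ### Modules as direct summands of Koszul objects -/

section KoszulRetract

open DerivedCategory

variable {R : Type u} [CommRing R] [IsNoetherianRing R]

/-- The Koszul object of a module on a sequence of scalars. -/
noncomputable abbrev koszulObj (N : FGModuleCat.{u} R) (xs : List R) :
    DerivedCategory (FGModuleCat.{u} R) :=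
  Q.obj (koszul ((CochainComplex.singleFunctor (FGModuleCat.{u} R) 0).obj N) xs)

scoped instance koszulObj_isLE (N : FGModuleCat.{u} R) (xs : List R) : (koszulObj N xs).IsLE 0 :=
  have : (Q.obj ((CochainComplex.singleFunctor (FGModuleCat.{u} R) 0).obj N)).IsLE 0 :=
    inferInstanceAs (((singleFunctor (FGModuleCat.{u} R) 0).obj N).IsLE 0)
  koszul_isLE _ 0 xs

lemma koszulObj_isGE (N : FGModuleCat.{u} R) (xs : List R) :
    (koszulObj N xs).IsGE (0 - xs.length) :=
  have : (Q.obj ((CochainComplex.singleFunctor (FGModuleCat.{u} R) 0).obj N)).IsGE 0 :=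
    inferInstanceAs (((singleFunctor (FGModuleCat.{u} R) 0).obj N).IsGE 0)
  koszul_isGE _ 0 xs

lemma koszulObj_bounded (N : FGModuleCat.{u} R) (xs : List R) :
    TStructure.t.bounded (koszulObj N xs) :=
  bounded_of_isGE_of_isLE (koszulObj_isGE N xs) (koszulObj_isLE N xs)

/-- The Koszul object of a module, as an object of the singularity category. -/
noncomputable abbrev koszulDsg (N : FGModuleCat.{u} R) (xs : List R) : Dsg R :=
  (perfect R).trW.Q.obj (⟨koszulObj N xs, koszulObj_bounded N xs⟩ : Db R)

lemma exists_koszulDsg_triangle (N : FGModuleCat.{u} R) (x : R) (xs : List R) :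
    ∃ (g : koszulDsg N xs ⟶ koszulDsg N (x :: xs))
      (h : koszulDsg N (x :: xs) ⟶ (koszulDsg N xs)⟦(1 : ℤ)⟧),
      Triangle.mk (x • 𝟙 (koszulDsg N xs)) g h ∈ distTriang (Dsg R) := by
  obtain ⟨g, h, hT⟩ := exists_koszul_triangle
    ((CochainComplex.singleFunctor (FGModuleCat.{u} R) 0).obj N) x xs
  obtain ⟨δ, hδ⟩ := exists_distinguished_of_ι TStructure.t.bounded
    (X := ⟨_, koszulObj_bounded N xs⟩) (Y := ⟨_, koszulObj_bounded N xs⟩)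
    (Z := ⟨_, koszulObj_bounded N (x :: xs)⟩) (x • 𝟙 _) (ObjectProperty.homMk g) h
    hT
  let E : Db R := ⟨koszulObj N xs, koszulObj_bounded N xs⟩
  have e : (perfect R).trW.Q.map (x • 𝟙 E) = x • 𝟙 (koszulDsg N xs) := by
    rw [Functor.map_smul, CategoryTheory.Functor.map_id]
  let E' : Db R := ⟨koszulObj N (x :: xs), koszulObj_bounded N (x :: xs)⟩
  let T := (perfect R).trW.Q.mapTriangle.obj
    (Triangle.mk (x • 𝟙 E) (ObjectProperty.homMk g : E ⟶ E') δ)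
  refine ⟨T.mor₂, T.mor₃, ?_⟩
  rw [← e]
  exact Q_map_distinguished hδ

/-- A module on which the scalars `xs` vanish in the singularity category is there a direct summand of
its Koszul object. -/
lemma nonempty_retract_koszulDsg (N : FGModuleCat.{u} R) (xs : List R)
    (h : ∀ x ∈ xs, x • 𝟙 ((toDsg R).obj N) = 0) :
    Nonempty (Retract ((toDsg R).obj N) (koszulDsg N xs)) ∧
      ∀ y : R, y • 𝟙 ((toDsg R).obj N) = 0 → y • 𝟙 (koszulDsg N xs) = 0 := by
  induction xs with
  | nil => exact ⟨⟨Retract.refl _⟩, fun y hy => hy⟩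
  | cons x xs ih =>
    obtain ⟨⟨r⟩, hr⟩ := ih fun x hx => h x (by simp [hx])
    obtain ⟨g, k, hT⟩ := exists_koszulDsg_triangle N x xs
    -- The second assertion is carried along for this: x still vanishes on the Koszul object built
    -- so far, so the next cone splits.
    have hx := hr x (h x (by simp))
    obtain ⟨r'⟩ := nonempty_retract_of_cone hx hT
    exact ⟨⟨r.trans r'⟩, fun y hy => smul_id_cone_eq_zero hx hT (hr y hy)⟩

variable {P : ObjectProperty (FGModuleCat.{u} R)} {S : ObjectProperty (Dsg R)} [S.IsTriangulated]
  [S.IsClosedUnderIsomorphisms]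

/-- The Koszul object of N lives only in degrees from c - `xs.length` to 0, and N is a summand of it
modulo perfect complexes. -/
lemma ballIn_of_homVanish (hPS : inDsg P ≤ S) {N : FGModuleCat.{u} R} (hN : S ((toDsg R).obj N))
    {xs : List R} (hxs : ∀ x ∈ xs, x • 𝟙 ((toDsg R).obj N) = 0)
    (hP : ∀ T : FGModuleCat.{u} R, (∀ x ∈ xs, x • 𝟙 T = 0) → IsZero T ∨ P T) {c : ℕ}
    (hc : ∀ T : FGModuleCat.{u} R, (∀ x ∈ xs, x • 𝟙 T = 0) →
      HomVanish ((singleFunctor (FGModuleCat.{u} R) 0).obj T)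
        ((singleFunctor (FGModuleCat.{u} R) 0).obj N) c) :
    ballIn (inDsg P) S (xs.length - c + 1) ((toDsg R).obj N) := by
  obtain ⟨⟨r⟩, -⟩ := nonempty_retract_koszulDsg N xs hxs
  refine ballIn.of_retract hN r ?_
  have : (Q.obj ((CochainComplex.singleFunctor (FGModuleCat.{u} R) 0).obj N)).IsGE 0 :=
    inferInstanceAs (((singleFunctor (FGModuleCat.{u} R) 0).obj N).IsGE 0)
  have : (Q.obj ((CochainComplex.singleFunctor (FGModuleCat.{u} R) 0).obj N)).IsLE 0 :=
    inferInstanceAs (((singleFunctor (FGModuleCat.{u} R) 0).obj N).IsLE 0)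
  have h : (koszulObj N xs).IsGE (c - xs.length) := koszul_isGE_of_homVanish _ (n := 0) hc
  have : (koszulObj N xs).IsGE (0 - (xs.length - c : ℕ)) :=
    TStructure.t.isGE_of_ge (koszulObj N xs) _ (c - xs.length) (by lia)
  exact ballIn_of_isGE_of_isLE hPS hP _ 0 _ _ fun x hx => smul_id_Q_koszul_eq_zero _ hx

end KoszulRetract

/-! ### Syzygies, grade and the radius -/

section Syzygy

open DerivedCategory

variable {R : Type u} [CommRing R] [IsNoetherianRing R] {X : ObjectProperty (FGModuleCat.{u} R)}

/-- Modulo perfect complexes, a module in a resolving subcategory is the shift of a module `N` in that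
subcategory such that `Ext^i(T, N) = 0` for `i < c`, for those `T` with `Ext^i(T, R) = 0` for
`i < c`. -/
lemma IsResolving.exists_syzygy_homVanish (hX : IsResolving X) (c : ℕ) {M : FGModuleCat.{u} R}
    (hM : X M) : ∃ (N : FGModuleCat.{u} R) (_ : X N),
      Nonempty ((toDsg R).obj M ≅ ((toDsg R).obj N)⟦(c : ℤ)⟧) ∧
      ∀ T : FGModuleCat.{u} R, HomVanish ((singleFunctor (FGModuleCat.{u} R) 0).obj T)
        ((singleFunctor (FGModuleCat.{u} R) 0).obj (FGModuleCat.of R R)) c →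
        HomVanish ((singleFunctor (FGModuleCat.{u} R) 0).obj T)
          ((singleFunctor (FGModuleCat.{u} R) 0).obj N) c := by
  induction c with
  | zero =>
    exact ⟨M, hM, ⟨(shiftFunctorZero _ ℤ).symm.app _⟩, fun T _ => homVanish_single_zero T M⟩
  | succ c ih =>
    obtain ⟨N, hN, ⟨e⟩, h⟩ := ih
    obtain ⟨n, K, i, p, w, hS⟩ := SpanierWhitehead.exists_syzygy N
    obtain ⟨δ, hδ⟩ := exists_toDb_triangle hS
    obtain ⟨e'⟩ := nonempty_iso_shift_of_free_triangle hδ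
    refine ⟨K, hX.kernel _ hS (hX.free n) hN, ⟨e ≪≫ (shiftFunctor _ (c : ℤ)).mapIso e' ≪≫
      (shiftFunctorAdd' _ 1 (c : ℤ) ((c + 1 : ℕ) : ℤ) (by push_cast; ring)).symm.app _⟩,
      fun T hT => ?_⟩
    -- Each syzygy gains one degree of vanishing, as long as the free middle term allows it.
    exact HomVanish.obj₁ hS.singleTriangle_distinguished (hT.free n)
      ((h T (hT.mono (by lia))).mono (by lia))

end Syzygy

section Radius

variable {R : Type u} [CommRing R] [IsNoetherianRing R]

lemma exists_isWeaklyRegular_of_le_idealGrade {I : Ideal R} {k : ℕ} (hk : (k : ℕ∞) ≤ idealGrade I) :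
    ∃ rs : List R, (∀ r ∈ rs, r ∈ I) ∧ RingTheory.Sequence.IsWeaklyRegular R rs ∧
      k ≤ rs.length := by
  cases k with
  | zero => exact ⟨[], by simp, .nil R R, le_rfl⟩
  | succ k =>
    have : (k : ℕ∞) < idealGrade I := lt_of_lt_of_le (by exact_mod_cast k.lt_succ_self) hk
    simp only [idealGrade, lt_iSup_iff] at this
    obtain ⟨rs, h, hrs⟩ := this
    exact ⟨rs, h.1, h.2, by exact_mod_cast hrs⟩

lemma exists_isWeaklyRegular_length (I : Ideal R) :
    ∃ rs : List R, (∀ r ∈ rs, r ∈ I) ∧ RingTheory.Sequence.IsWeaklyRegular R rs ∧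
      I.spanFinrank - rs.length + 1 ≤ radius I := by
  obtain ⟨k, hk, hr⟩ : ∃ k : ℕ, (k : ℕ∞) ≤ idealGrade I ∧
      I.spanFinrank - k + 1 ≤ radius I := by
    rw [radius]
    cases h : idealGrade I with
    -- For infinite grade, a regular sequence of length μ(I) already brings the radius down to 1.
    | top => exact ⟨I.spanFinrank, le_top, by simp⟩
    | coe g => exact ⟨g, le_rfl, by
        
        rw [← ENat.natCast_sub, ← Nat.cast_one (R := ℕ∞), ← Nat.cast_add, ENat.toNat_natCast]⟩
  obtain ⟨rs, h₁, h₂, h₃⟩ := exists_isWeaklyRegular_of_le_idealGrade hk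
  exact ⟨rs, h₁, h₂, by lia⟩

lemma exists_list_span_eq (I : Ideal R) :
    ∃ ys : List R, Ideal.span {y | y ∈ ys} = I ∧ ys.length = I.spanFinrank := by
  obtain ⟨s, hs, h⟩ := Submodule.FG.exists_span_finset_card_eq_spanFinrank
    ((isNoetherianRing_iff_ideal_fg R).1 inferInstance I)
  exact ⟨s.toList, by simpa using h, by simpa using hs⟩

lemma smul_id_eq_zero_iff (T : FGModuleCat.{u} R) (x : R) :
    x • 𝟙 T = 0 ↔ x ∈ Module.annihilator R T := by
  rw [Module.mem_annihilator]
  refine ⟨fun h m => congrArg (fun f : T ⟶ T => f.hom.hom m) h, fun h => ?_⟩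
  ext m
  exact h m

end Radius

/-! ### The radius estimate for SW(X) -/

section Main

open DerivedCategory

variable {R : Type u} [CommRing R] [IsNoetherianRing R] {X : ObjectProperty (FGModuleCat.{u} R)}
  {I : Ideal R}

/-- If, in the singularity category, every module in a resolving subcategory `X` is killed by a
sequence of `μ(I)` scalars, then every object of `SW X` lies in the ball of radius
`μ(I) - grade I + 1` centered at the modules killed by these sequences. -/
lemma IsResolving.ballIn_SW (hX : IsResolving X) [(SW X).IsTriangulated]
    {P : ObjectProperty (FGModuleCat.{u} R)} (hP : inDsg P ≤ SW X)
    (H : ∀ N, X N → ∃ xs : List R, xs.length = I.spanFinrank ∧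
      (∀ x ∈ xs, x • 𝟙 ((toDsg R).obj N) = 0) ∧
      ∀ T : FGModuleCat.{u} R, (∀ x ∈ xs, x • 𝟙 T = 0) →
        I ≤ (Module.annihilator R T).radical ∧ (IsZero T ∨ P T))
    {Z : Dsg R} (hZ : SW X Z) : ballIn (inDsg P) (SW X) (radius I) Z := by
  obtain ⟨M, m, hM, ⟨e⟩⟩ := id hZ
  obtain ⟨rs, hrs, hreg, hr⟩ := exists_isWeaklyRegular_length I
  obtain ⟨N, hN, ⟨e'⟩, hv⟩ := hX.exists_syzygy_homVanish rs.length hM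
  -- The scalars may depend on N, so the syzygy is taken first; their number does not. They are
  -- unrelated to `rs`, whose elements act nilpotently on T because they lie in I.
  obtain ⟨xs, hlen, hxs, hT⟩ := H N hN
  have := ballIn_of_homVanish hP (SW_of_mem hN) hxs (fun T h => (hT T h).2) fun T h =>
    hv T (homVanish_of_isWeaklyRegular T rs (fun r hr => by
      obtain ⟨k, hk⟩ := (hT T h).1 (hrs r hr)
      exact ⟨k, (smul_id_eq_zero_iff T _).2 hk⟩) R hreg)
  rw [hlen] at this
  exact ((this.mono hr).shift _ |>.shift m).of_retract hZ
    (.ofIso (e ≪≫ (shiftFunctor _ m).mapIso e'))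

lemma inDsg_filt_le_SW [(SW X).IsTriangulated]
    (hSW : ∀ p ∈ PrimeSpectrum.zeroLocus (I : Set R),
      SW X ((toDsg R).obj (FGModuleCat.of R (R ⧸ p.asIdeal)))) :
    inDsg (Filt (cyclicPrimes I)) ≤ SW X := by
  rintro _ ⟨M, hM, ⟨e⟩⟩
  refine (SW X).prop_of_iso e ?_
  clear e
  induction hM with
  | of_mem h =>
    obtain ⟨p, hp, ⟨e⟩⟩ := h
    exact (SW X).prop_of_iso ((toDsg R).mapIso e.symm) (hSW p hp)
  | of_iso e _ ih => exact (SW X).prop_of_iso ((toDsg R).mapIso e) ih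
  | extension S hS _ _ h₁ h₃ =>
    obtain ⟨δ, hδ⟩ := exists_toDb_triangle hS
    exact (SW X).ext_of_isTriangulatedClosed₂ _ (Q_map_distinguished hδ) h₁ h₃

lemma inDsg_modQuotient_le_SW [(SW X).IsTriangulated]
    (hSW : ∀ p ∈ PrimeSpectrum.zeroLocus (I : Set R),
      SW X ((toDsg R).obj (FGModuleCat.of R (R ⧸ p.asIdeal)))) :
    inDsg (modQuotient I) ≤ SW X := by
  rintro _ ⟨M, hM, ⟨e⟩⟩
  refine (SW X).prop_of_iso e ?_
  obtain h | h := filt_cyclicPrimes I M (hM.trans Ideal.le_radical)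
  · exact (SW X).prop_of_isZero ((toDsg R).map_isZero (isZero_of_subsingleton M h))
  · exact inDsg_filt_le_SW hSW _ ⟨M, h, ⟨Iso.refl _⟩⟩

lemma ball_eq_top [(SW X).IsTriangulated] {P : ObjectProperty (Dsg R)} {r : ℕ}
    (h : ∀ Z, SW X Z → ballIn P (SW X) r Z) : ball (P.inverseImage (SW X).ι) r = ⊤ := by
  refine top_le_iff.1 fun Z _ => ?_
  obtain ⟨_, hZ⟩ := h Z.obj Z.property
  exact hZ

/-- The powers of the generators of `I` which kill a module `N` in the singularity category. -/
lemma exists_list_smul_eq_zero (N : FGModuleCat.{u} R) (hN : ipd N ⊆ PrimeSpectrum.zeroLocus I) :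
    ∃ xs : List R, xs.length = I.spanFinrank ∧ (∀ x ∈ xs, x • 𝟙 ((toDsg R).obj N) = 0) ∧
      ∀ T : FGModuleCat.{u} R, (∀ x ∈ xs, x • 𝟙 T = 0) →
        I ≤ (Module.annihilator R T).radical := by
  obtain ⟨ys, hys, hlen⟩ := exists_list_span_eq I
  have h (y : R) : ∃ k : ℕ, y ∈ I → y ^ k • 𝟙 ((toDsg R).obj N) = 0 := by
    by_cases hy : y ∈ I
    · obtain ⟨k, hk⟩ := exists_pow_smul_eq_zero N (x := y) fun q hq => hN hq hy
      exact ⟨k, fun _ => hk⟩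
    · exact ⟨0, fun h => absurd h hy⟩
  choose k hk using h
  refine ⟨ys.map fun y => y ^ k y, by simpa using hlen, fun x hx => ?_, fun T hT => ?_⟩
  · obtain ⟨y, hy, rfl⟩ := List.mem_map.1 hx
    exact hk y (hys ▸ Ideal.subset_span hy)
  · rw [← hys, Ideal.span_le]
    exact fun y hy => ⟨k y, (smul_id_eq_zero_iff T _).1 (hT _ (List.mem_map.2 ⟨y, hy, rfl⟩))⟩

end Main

end SpanierWhitehead

theorem mainTheorem1 {R : Type u} [CommRing R] [IsNoetherianRing R]
    (X : ObjectProperty (FGModuleCat.{u} R)) (hX : SpanierWhitehead.IsResolving X)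
    (I : Ideal R)
    (hIPD : SpanierWhitehead.ipdLocus X ⊆ PrimeSpectrum.zeroLocus (I : Set R))
    (hSW : ∀ p ∈ PrimeSpectrum.zeroLocus (I : Set R), SpanierWhitehead.SW X
      ((SpanierWhitehead.toDsg R).obj (FGModuleCat.of R (R ⧸ p.asIdeal)))) :
    ∃ _ : (SpanierWhitehead.SW X).IsTriangulated,
      (SpanierWhitehead.inDsg (SpanierWhitehead.Filt (SpanierWhitehead.cyclicPrimes I)) ≤
          SpanierWhitehead.SW X ∧
        SpanierWhitehead.ball
          ((SpanierWhitehead.inDsg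
              (SpanierWhitehead.Filt (SpanierWhitehead.cyclicPrimes I))).inverseImage
            (SpanierWhitehead.SW X).ι)
          (SpanierWhitehead.radius I) = ⊤) ∧
      (I ≤ SpanierWhitehead.ann (SpanierWhitehead.SW X) →
        SpanierWhitehead.inDsg (SpanierWhitehead.modQuotient I) ≤ SpanierWhitehead.SW X ∧
        SpanierWhitehead.ball
          ((SpanierWhitehead.inDsg (SpanierWhitehead.modQuotient I)).inverseImage
            (SpanierWhitehead.SW X).ι)
          (SpanierWhitehead.radius I) = ⊤) := by
  have hT := hX.isTriangulated_SW
  have hfilt := SpanierWhitehead.inDsg_filt_le_SW hSW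
  have hmod := SpanierWhitehead.inDsg_modQuotient_le_SW hSW
  refine ⟨hT, ⟨hfilt, SpanierWhitehead.ball_eq_top fun Z hZ =>
    hX.ballIn_SW hfilt (fun N hN => ?_) hZ⟩, fun hI => ⟨hmod, SpanierWhitehead.ball_eq_top
      fun Z hZ => hX.ballIn_SW hmod (fun N hN => ?_) hZ⟩⟩
  -- Only powers of the generators kill N here, so the cohomology is merely supported on V(I).
  · obtain ⟨xs, h₁, h₂, h₃⟩ := SpanierWhitehead.exists_list_smul_eq_zero N
      fun p hp => hIPD ⟨N, hN, hp⟩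
    exact ⟨xs, h₁, h₂, fun T hT => ⟨h₃ T hT, (SpanierWhitehead.filt_cyclicPrimes I T (h₃ T hT)).imp_left
      (SpanierWhitehead.isZero_of_subsingleton T)⟩⟩
  -- The generators themselves kill N, so modules killed by them are killed by I.
  · obtain ⟨xs, hspan, hlen⟩ := SpanierWhitehead.exists_list_span_eq I
    refine ⟨xs, hlen, fun x hx => ?_, fun T hT => ?_⟩
    · have h : x ∈ SpanierWhitehead.ann (SpanierWhitehead.SW X) :=
        hI (hspan ▸ Ideal.subset_span (α := R) hx)
      simp only [SpanierWhitehead.ann, Ideal.mem_iInf] at h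
      exact Module.mem_annihilator.1 (h _ (SpanierWhitehead.SW_of_mem hN)) _
    · have h : I ≤ Module.annihilator R T := by
        rw [← hspan, Ideal.span_le]
        exact fun x hx => (SpanierWhitehead.smul_id_eq_zero_iff T x).1 (hT x hx)
      exact ⟨h.trans Ideal.le_radical, .inr h⟩
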